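/- Let $n\ge 1$, $0<p<1$, $0<q\le\infty$, $s\in\mathbb{R}$, and let $\Phi:\mathbb{R}^n\to\mathbb{C}$ belong to $L^1_{\mathrm{loc}}(\mathbb{R}^n\setminus\{0\})$. The Hausdorff operator is $$H_\Phi f(x)=\int_{\mathbb{R}^n}\Phi(y)\,f\!\left(\frac{x}{|y|}\right)dy ,$$ and its natural domain $\mathrm{Dom}(H_\Phi)$ is the set of all measurable $f:\mathbb{R}^n\to\mathbb{C}$ for which this integral converges absolutely for almost every $x$. Function spaces. Let $\varphi\in C^\infty(\mathbb{R}^n;\mathbb{R})$ be supported in $\{|\xi|<3/2\}$ with $\varphi=1$ on $\{|\xi|\le 4/3\}$, put $\phi_0=\varphi$, $\phi_j(\xi)=\varphi(2^{-j}\xi)-\varphi(2\cdot 2^{-j}\xi)$ for $j\ge1$, and $\Delta_j=\mathscr{F}^{-1}\phi_j\mathscr{F}$. Let $\eta\in C^\infty(\mathbb{R}^n;[0,1])$ with $\eta(\xi)=1$ for $|\xi|_\infty\le 1/2$ and $\eta(\xi)=0$ for $|\xi|_\infty\ge 3/4$, put $\sigma_k(\xi)=\eta(\xi-k)\big/\sum_{l\in\mathbb{Z}^n}\eta(\xi-l)$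 and $\Box_k=\mathscr{F}^{-1}\sigma_k\mathscr{F}$ for $k\in\mathbb{Z}^n$. With $\langle k\rangle=(1+|k|^2)^{1/2}$, the spaces $F_s^{p,q}$, $B_s^{p,q}$, $M_s^{p,q}$ consist of all tempered distributions $f$ on $\mathbb{R}^n$ for which, respectively, $$\|f\|_{F_s^{p,q}}=\Big\|\Big(\sum_{j\ge0}2^{jsq}|\Delta_jf|^q\Big)^{1/q}\Big\|_{L^p},\quad \|f\|_{B_s^{p,q}}=\Big(\sum_{j\ge0}2^{jsq}\|\Delta_jf\|_{L^p}^q\Big)^{1/q},\quad \|f\|_{M_s^{p,q}}=\Big(\sum_{k\in\mathbb{Z}^n}\langle k\rangle^{sq}\|\Box_kf\|_{L^p}^q\Big)^{1/q}$$ is finite (with a supremum in place of the sum if $q=\infty$). A locally integrable function is regarded as an element of such a space if it coincides, as a distribution, with a tempered distribution in the space. Let $X$ be any of $F_s^{p,q}$, $B_s^{p,q}$, $M_s^{p,q}$, and let $\mathcal{D}$ be any set of functions with $C_c^\infty(\mathbb{R}^n\setminus\{0\})\subset\mathcal{D}\subset\mathrm{Dom}(H_\Phi)$ (for instance $\mathcal{D}=\mathrm{Dom}(H_\Phi)$).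 Say that $H_\Phi$, with domain $\mathcal{D}$, is bounded on $X$ if there is a constant $C<\infty$ such that, for every $f\in\mathcal{D}\cap X$, one has $H_\Phi f\in X$ and $\|H_\Phi f\|_X\le C\|f\|_X$. Then $$H_\Phi\ \text{is bounded on}\ X\iff H_\Phi=0,$$ where $H_\Phi=0$ means that $H_\Phi f=0$ almost everywhere for every $f\in\mathrm{Dom}(H_\Phi)$. -/

import Mathlib

open MeasureTheory SchwartzMap
open scoped ENNReal NNReal ContDiff

noncomputable section

namespace HausdorffOp

/-- The Euclidean space `ℝⁿ`. -/
abbrev Rn (n : ℕ) : Type := EuclideanSpace ℝ (Fin n)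

variable {n : ℕ}

/-! ### Functions as tempered distributions -/

/-- The tempered distribution `u` is the locally integrable function `f`:
`⟨u, g⟩ = ∫ g f` for all `g ∈ C_c^∞(ℝⁿ)`. (As `C_c^∞` is dense in `𝓢`, such a `u` is unique.) -/
def Represents (f : Rn n → ℂ) (u : 𝓢'(Rn n, ℂ)) : Prop :=
  LocallyIntegrable f ∧
    ∀ g : 𝓢(Rn n, ℂ), HasCompactSupport g → u g = ∫ x, g x * f x

/-- The `L^p` (quasi-)norm of a tempered distribution; it is `∞` if `u` is not a locally
integrable function. (All functions representing `u` agree almost everywhere.) -/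
def distLpNorm (p : ℝ≥0∞) (u : 𝓢'(Rn n, ℂ)) : ℝ≥0∞ :=
  ⨅ (f : Rn n → ℂ) (_ : Represents f u), eLpNorm f p volume

/-- The `ℓ^q` (quasi-)norm, `0 < q ≤ ∞`, of a family in `[0, ∞]`. -/
def lqNorm {ι : Type} (q : ℝ≥0∞) (a : ι → ℝ≥0∞) : ℝ≥0∞ :=
  if q = ⊤ then ⨆ i, a i else (∑' i, a i ^ q.toReal) ^ (1 / q.toReal)

/-! ### Besov and Triebel-Lizorkin spaces -/

/-- A smooth bump function supported in `{|ξ| < 3/2}` and equal to `1` on `{|ξ| ≤ 4/3}`. -/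
structure IsDyadicBump (φ : Rn n → ℝ) : Prop where
  smooth : ContDiff ℝ ∞ φ
  support_subset : Function.support φ ⊆ Metric.ball 0 (3 / 2)
  eq_one : ∀ ξ, ‖ξ‖ ≤ 4 / 3 → φ ξ = 1

/-- The dyadic decomposition: `φ_0 = φ` and `φ_j(ξ) = φ(2^{-j} ξ) - φ(2 · 2^{-j} ξ)`, `j ≥ 1`. -/
def dyadicSymbol (φ : Rn n → ℝ) : ℕ → Rn n → ℝ
  | 0 => φ
  | j + 1 => fun ξ => φ (((2 : ℝ) ^ (j + 1))⁻¹ • ξ) - φ ((2 : ℝ) • ((2 : ℝ) ^ (j + 1))⁻¹ • ξ)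

/-- The Littlewood-Paley operator `Δ_j = 𝓕⁻¹ φ_j 𝓕` on tempered distributions. -/
def lpOp (φ : Rn n → ℝ) (j : ℕ) (u : 𝓢'(Rn n, ℂ)) : 𝓢'(Rn n, ℂ) :=
  TemperedDistribution.fourierMultiplierCLM ℂ (fun ξ => (dyadicSymbol φ j ξ : ℂ)) u

/-- The (quasi-)norm of `B_s^{p,q}`: the `ℓ^q` norm of `2^{js} ‖Δ_j u‖_{L^p}`. -/
def besovNorm (φ : Rn n → ℝ) (p q : ℝ≥0∞) (s : ℝ) (u : 𝓢'(Rn n, ℂ)) : ℝ≥0∞ :=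
  lqNorm q fun j : ℕ => (2 : ℝ≥0∞) ^ ((j : ℝ) * s) * distLpNorm p (lpOp φ j u)

/-- The (quasi-)norm of `F_s^{p,q}`: the `L^p` norm of the pointwise `ℓ^q` norm of
`2^{js} |Δ_j u|`. The infimum only serves to read `Δ_j u` as a function `g j`, which is unique up
to null sets. -/
def triebelLizorkinNorm (φ : Rn n → ℝ) (p q : ℝ≥0∞) (s : ℝ) (u : 𝓢'(Rn n, ℂ)) : ℝ≥0∞ :=
  ⨅ (g : ℕ → Rn n → ℂ) (_ : ∀ j, Represents (g j) (lpOp φ j u)),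
    eLpNorm (fun x => lqNorm q fun j : ℕ => (2 : ℝ≥0∞) ^ ((j : ℝ) * s) * ‖g j x‖ₑ) p volume

/-! ### Modulation spaces -/

/-- A smooth function with values in `[0, 1]`, equal to `1` for `|ξ|_∞ ≤ 1/2` and to `0` for
`|ξ|_∞ ≥ 3/4`. -/
structure IsUniformBump (η : Rn n → ℝ) : Prop where
  smooth : ContDiff ℝ ∞ η
  mem_Icc : ∀ ξ, η ξ ∈ Set.Icc (0 : ℝ) 1
  eq_one : ∀ ξ, (∀ i, |ξ i| ≤ 1 / 2) → η ξ = 1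
  eq_zero : ∀ ξ, (∃ i, 3 / 4 ≤ |ξ i|) → η ξ = 0

/-- The lattice point `k ∈ ℤⁿ` as a vector of `ℝⁿ`. -/
def latticePt (k : Fin n → ℤ) : Rn n := WithLp.toLp 2 fun i => (k i : ℝ)

/-- The uniform partition of unity `σ_k(ξ) = η(ξ - k) / ∑_l η(ξ - l)`. (The sum is locally
finite.) -/
def uniformSymbol (η : Rn n → ℝ) (k : Fin n → ℤ) (ξ : Rn n) : ℝ :=
  η (ξ - latticePt k) / ∑' l : Fin n → ℤ, η (ξ - latticePt l)

/-- The frequency-uniform decomposition operator `□_k = 𝓕⁻¹ σ_k 𝓕`. -/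
def boxOp (η : Rn n → ℝ) (k : Fin n → ℤ) (u : 𝓢'(Rn n, ℂ)) : 𝓢'(Rn n, ℂ) :=
  TemperedDistribution.fourierMultiplierCLM ℂ (fun ξ => (uniformSymbol η k ξ : ℂ)) u

/-- The (quasi-)norm of `M_s^{p,q}`: the `ℓ^q` norm of `⟨k⟩^s ‖□_k u‖_{L^p}`. -/
def modulationNorm (η : Rn n → ℝ) (p q : ℝ≥0∞) (s : ℝ) (u : 𝓢'(Rn n, ℂ)) : ℝ≥0∞ :=
  lqNorm q fun k : Fin n → ℤ =>
    ENNReal.ofReal ((1 + ‖latticePt k‖ ^ 2) ^ (s / 2)) * distLpNorm p (boxOp η k u)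

/-! ### Hausdorff operators -/

/-- `H_Φ f(x) = ∫ Φ(y) f(x / |y|) dy`. -/
def hausdorff (Φ f : Rn n → ℂ) (x : Rn n) : ℂ :=
  ∫ y, Φ y * f (‖y‖⁻¹ • x)

/-- The natural domain of `H_Φ`: the measurable `f` such that the integral defining `H_Φ f(x)`
converges absolutely for almost every `x`. -/
def hausdorffDomain (Φ : Rn n → ℂ) : Set (Rn n → ℂ) :=
  {f | AEStronglyMeasurable f volume ∧ ∀ᵐ x, Integrable fun y => Φ y * f (‖y‖⁻¹ • x)}

/-- `C_c^∞(ℝⁿ ∖ {0})`. -/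
def testAwayFromZero (n : ℕ) : Set (Rn n → ℂ) :=
  {f | ContDiff ℝ ∞ f ∧ HasCompactSupport f ∧ (0 : Rn n) ∉ tsupport f}

/-- `H_Φ`, with domain `𝒟`, is bounded on the space `X` of the tempered distributions whose
(quasi-)norm `N` is finite: `H_Φ f ∈ X` and `‖H_Φ f‖_X ≤ C ‖f‖_X` for all `f ∈ 𝒟 ∩ X`. -/
def IsBoundedOn (Φ : Rn n → ℂ) (𝒟 : Set (Rn n → ℂ)) (N : 𝓢'(Rn n, ℂ) → ℝ≥0∞) : Prop :=
  ∃ C : ℝ≥0, ∀ f ∈ 𝒟, ∀ u : 𝓢'(Rn n, ℂ), Represents f u → N u < ⊤ →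
    ∃ v : 𝓢'(Rn n, ℂ), Represents (hausdorff Φ f) v ∧ N v ≤ C * N u

/-- `H_Φ = 0`: `H_Φ f = 0` almost everywhere for every `f` in the natural domain of `H_Φ`. -/
def IsZeroOp (Φ : Rn n → ℂ) : Prop :=
  ∀ f ∈ hausdorffDomain Φ, ∀ᵐ x, hausdorff Φ f x = 0

end HausdorffOp

end

/-!
Suppose that `H_Φ` is bounded on `X`, and apply this to the dilates `f(t⁻¹ ·)` of a test function.
Dilations commute with `H_Φ`, and as `t → ∞` they concentrate the frequencies near `0`, so
that only the low-frequency block of the decomposition survives, and on that block the (quasi-)norm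
of `X` is comparable to that of `L^p`. In the limit, `‖H_Φ f‖_p ≤ C ‖f‖_p` on test functions.

For `f(x) = b(log ‖x‖)`, logarithmic polar coordinates turn `H_Φ f` into the convolution of `b` with
the radial density `A` of `Φ`. Let `b` run through an approximate identity centred at `1`. The
functions `f` stay bounded in `L¹` and their supports shrink to a null set, so that `‖f‖_p → 0` by
Hölder's inequality because `p < 1`. But `H_Φ f` tends to `A(log ‖x‖ - 1)` almost everywhere, so
`A = 0` by Fatou's lemma, and hence `H_Φ = 0`.
-/

noncomputable section

open Filter Topology
open scoped FourierTransform Convolution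

namespace HausdorffOp

/-! ### Multiplication and dilation on the Schwartz space -/

section Schwartz

variable {E F : Type*} [NormedAddCommGroup E] [NormedSpace ℝ E]
  [NormedAddCommGroup F] [NormedSpace ℂ F]

lemma seminorm_smulLeftCLM_le (f : 𝓢(E, F)) (k l P : ℕ) {μ : E → ℂ} (hμ : μ.HasTemperateGrowth)
    {A : ℝ} (hA : ∀ j ≤ l, ∀ ξ, ‖iteratedFDeriv ℝ j μ ξ‖ ≤ A * (1 + ‖ξ‖) ^ P) :
    SchwartzMap.seminorm ℂ k l (smulLeftCLM F μ f) ≤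
      2 ^ l * (2 ^ (k + P) * (Finset.Iic (k + P, l)).sup
        (fun m => SchwartzMap.seminorm ℂ m.1 m.2) f) * A := by
  set S := (Finset.Iic (k + P, l)).sup (fun m => SchwartzMap.seminorm ℂ m.1 m.2) f
  have hS : 0 ≤ S := apply_nonneg _ _
  have hA0 : 0 ≤ A := by simpa using (norm_nonneg _).trans (hA 0 l.zero_le 0)
  refine SchwartzMap.seminorm_le_bound ℂ k l _ (by positivity) fun ξ => ?_
  have leibniz : ‖iteratedFDeriv ℝ l (smulLeftCLM F μ f) ξ‖ ≤
      ∑ i ∈ Finset.range (l + 1), (l.choose i : ℝ) * ‖iteratedFDeriv ℝ i μ ξ‖ *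
        ‖iteratedFDeriv ℝ (l - i) f ξ‖ := by
    rw [smulLeftCLM_apply hμ]
    exact norm_iteratedFDeriv_smul_le (N := ∞) hμ.1 (f.smooth ⊤) ξ (by exact_mod_cast le_top)
  have leibniz_term : ∀ i ∈ Finset.range (l + 1),
      ‖ξ‖ ^ k * ((l.choose i : ℝ) * ‖iteratedFDeriv ℝ i μ ξ‖ * ‖iteratedFDeriv ℝ (l - i) f ξ‖) ≤
        (l.choose i : ℝ) * (2 ^ (k + P) * S * A) := by
    intro i hi
    have hil : i ≤ l := Nat.lt_succ_iff.mp (Finset.mem_range.mp hi)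
    calc _ ≤ (1 + ‖ξ‖) ^ k * ((l.choose i : ℝ) * (A * (1 + ‖ξ‖) ^ P) *
            ‖iteratedFDeriv ℝ (l - i) f ξ‖) := by
          gcongr
          · linarith
          · exact hA i hil ξ
      _ = (l.choose i : ℝ) *
            (((1 + ‖ξ‖) ^ (k + P) * ‖iteratedFDeriv ℝ (l - i) f ξ‖) * A) := by
          rw [pow_add]; ring
      _ ≤ (l.choose i : ℝ) * (2 ^ (k + P) * S * A) := by
          gcongr (l.choose i : ℝ) * (?_ * A)
          exact one_add_le_sup_seminorm_apply (𝕜 := ℂ) (m := (k + P, l)) le_rfl (Nat.sub_le _ _) f ξ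
  calc _ ≤ ∑ i ∈ Finset.range (l + 1), (l.choose i : ℝ) * (2 ^ (k + P) * S * A) := by
        refine (mul_le_mul_of_nonneg_left leibniz (by positivity)).trans ?_
        rw [Finset.mul_sum]
        exact Finset.sum_le_sum leibniz_term
    _ = 2 ^ l * (2 ^ (k + P) * S) * A := by
        rw [← Finset.sum_mul, ← Nat.cast_sum, Nat.sum_range_choose]
        push_cast
        ring

lemma exists_seminorm_smulLeftCLM_le (Q : Seminorm ℂ 𝓢(E, F)) (hQ : Continuous Q) (f : 𝓢(E, F))
    (P : ℕ) (K : ℕ → ℝ) :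
    ∃ C : ℝ, 0 ≤ C ∧ ∀ μ : E → ℂ, μ.HasTemperateGrowth → ∀ ε : ℝ, 0 ≤ ε →
      (∀ j ξ, ‖iteratedFDeriv ℝ j μ ξ‖ ≤ ε * K j * (1 + ‖ξ‖) ^ P) →
      Q (smulLeftCLM F μ f) ≤ C * ε := by
  obtain ⟨s, C, -, hQC⟩ := Seminorm.bound_of_continuous (schwartz_withSeminorms ℂ E F) Q hQ
  let T : ℕ × ℕ → ℝ := fun i =>
    2 ^ i.2 * (2 ^ (i.1 + P) * (Finset.Iic (i.1 + P, i.2)).sup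
      (fun m => SchwartzMap.seminorm ℂ m.1 m.2) f) * ∑ j ∈ Finset.range (i.2 + 1), |K j|
  have hT : ∀ i, 0 ≤ T i := fun i => by positivity
  have hT_sum : 0 ≤ ∑ i ∈ s, T i := Finset.sum_nonneg fun i _ => hT i
  refine ⟨C * ∑ i ∈ s, T i, by positivity, fun μ hμ ε hε hμK => (hQC _).trans ?_⟩
  rw [_root_.smul_apply, NNReal.smul_def, smul_eq_mul, mul_assoc]
  gcongr
  refine Seminorm.finset_sup_apply_le (by positivity) fun i hi => ?_
  calc SchwartzMap.seminorm ℂ i.1 i.2 (smulLeftCLM F μ f)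
      ≤ _ * (ε * ∑ j ∈ Finset.range (i.2 + 1), |K j|) := by
        refine seminorm_smulLeftCLM_le f i.1 i.2 P hμ fun j hj ξ => (hμK j ξ).trans ?_
        gcongr
        exact (le_abs_self _).trans (Finset.single_le_sum (f := fun j => |K j|)
          (fun j _ => abs_nonneg _) (Finset.mem_range.mpr (Nat.lt_succ_of_le hj)))
    _ = T i * ε := by simp only [T]; ring
    _ ≤ _ := by
        gcongr
        exact Finset.single_le_sum (f := T) (fun j _ => hT j) hi

/- The factor `ρ⁻¹ ^ P` comes from `1 ≤ ρ⁻¹ (1 + ‖ξ‖)`, true wherever `μ` does not vanish. -/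
lemma exists_seminorm_smulLeftCLM_le_of_eq_zero (Q : Seminorm ℂ 𝓢(E, F)) (hQ : Continuous Q)
    (f : 𝓢(E, F)) (P : ℕ) (K : ℕ → ℝ) :
    ∃ C : ℝ, 0 ≤ C ∧ ∀ μ : E → ℂ, μ.HasTemperateGrowth → ∀ ρ : ℝ, 0 < ρ →
      (∀ j ξ, ‖iteratedFDeriv ℝ j μ ξ‖ ≤ K j) → (∀ ξ, ‖ξ‖ < ρ → μ ξ = 0) →
      Q (smulLeftCLM F μ f) ≤ C * ρ⁻¹ ^ P := by
  obtain ⟨C, hC₀, hC⟩ := exists_seminorm_smulLeftCLM_le Q hQ f P K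
  refine ⟨C, hC₀, fun μ hμ ρ hρ hK hμ_zero => hC μ hμ _ (by positivity) fun j ξ => ?_⟩
  have hK₀ : 0 ≤ K j := (norm_nonneg _).trans (hK j ξ)
  rcases lt_or_ge ‖ξ‖ ρ with hξ | hξ
  · have : μ =ᶠ[𝓝 ξ] 0 := by
      filter_upwards [(isOpen_lt continuous_norm continuous_const).mem_nhds hξ] with y hy
      exact hμ_zero y hy
    rw [(this.iteratedFDeriv ℝ j).self_of_nhds, iteratedFDeriv_zero]
    simp only [Pi.zero_apply, norm_zero]
    positivity
  · have hone : 1 ≤ (ρ⁻¹ * (1 + ‖ξ‖)) ^ P := by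
      refine one_le_pow₀ ?_
      rw [inv_mul_eq_div, one_le_div hρ]
      linarith
    calc _ ≤ K j * 1 := by rw [mul_one]; exact hK j ξ
      _ ≤ K j * (ρ⁻¹ * (1 + ‖ξ‖)) ^ P := by gcongr
      _ = _ := by rw [mul_pow]; ring

lemma tendsto_nhds_of_seminorm_sub {α : Type*} {l : Filter α} {G : α → 𝓢(E, F)} {g : 𝓢(E, F)}
    (h : ∀ k m : ℕ, Tendsto (fun a => SchwartzMap.seminorm ℂ k m (G a - g)) l (𝓝 0)) :
    Tendsto G l (𝓝 g) := by
  rw [(schwartz_withSeminorms ℂ E F).tendsto_nhds]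
  exact fun i ε hε => (h i.1 i.2).eventually (gt_mem_nhds hε)

lemma continuous_seminorm (k l : ℕ) :
    Continuous (SchwartzMap.seminorm ℂ k l : Seminorm ℂ 𝓢(E, F)) :=
  (schwartz_withSeminorms ℂ E F).continuous_seminorm (k, l)

lemma norm_iteratedFDeriv_comp_smul_le {b : E → F} (hb : ContDiff ℝ ∞ b) {K : ℕ → ℝ}
    (hK : ∀ j ξ, ‖iteratedFDeriv ℝ j b ξ‖ ≤ K j) {c : ℝ} (hc : |c| ≤ 1) (j : ℕ) (ξ : E) :
    ‖iteratedFDeriv ℝ j (fun ξ => b (c • ξ)) ξ‖ ≤ K j := by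
  rw [iteratedFDeriv_comp_const_smul c (hb.of_le (by exact_mod_cast le_top)), norm_smul, norm_pow,
    Real.norm_eq_abs]
  exact (mul_le_of_le_one_left (norm_nonneg _) (pow_le_one₀ (abs_nonneg c) hc)).trans (hK j _)

lemma norm_iteratedFDeriv_const_sub_le {b : E → F} (hb : ContDiff ℝ ∞ b) {K : ℕ → ℝ}
    (hK : ∀ j ξ, ‖iteratedFDeriv ℝ j b ξ‖ ≤ K j) (a : F) (j : ℕ) (ξ : E) :
    ‖iteratedFDeriv ℝ j (fun ξ => a - b ξ) ξ‖ ≤ ‖a‖ + K j := by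
  change ‖iteratedFDeriv ℝ j ((fun _ => a) - b) ξ‖ ≤ _
  rw [iteratedFDeriv_sub_apply contDiffAt_const
    (hb.of_le (by exact_mod_cast le_top)).contDiffAt]
  refine (norm_sub_le _ _).trans (add_le_add ?_ (hK j ξ))
  rcases j.eq_zero_or_pos with rfl | hj
  · rw [norm_iteratedFDeriv_zero]
  · rw [iteratedFDeriv_const_of_ne hj.ne', Pi.zero_apply, norm_zero]
    exact norm_nonneg a

lemma norm_iteratedFDeriv_comp_smul_sub_le (b : 𝓢(E, F)) {c : ℝ} (hc : |c| ≤ 1) (j : ℕ) (ξ : E) :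
    ‖iteratedFDeriv ℝ j (fun ξ => b (c • ξ) - b 0) ξ‖ ≤
      |c| * (SchwartzMap.seminorm ℂ 0 j b + SchwartzMap.seminorm ℂ 0 1 b) * (1 + ‖ξ‖) ^ 1 := by
  have hbj : 0 ≤ SchwartzMap.seminorm ℂ 0 j b := apply_nonneg _ _
  have hb1 : 0 ≤ SchwartzMap.seminorm ℂ 0 1 b := apply_nonneg _ _
  rw [pow_one]
  rcases j.eq_zero_or_pos with rfl | hj
  · have mean_value : ‖b (c • ξ) - b 0‖ ≤ SchwartzMap.seminorm ℂ 0 1 b * ‖c • ξ - 0‖ :=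
      convex_univ.norm_image_sub_le_of_norm_fderiv_le (𝕜 := ℝ) (fun x _ => b.differentiableAt)
        (fun x _ => by
          rw [← norm_iteratedFDeriv_one]
          exact b.norm_iteratedFDeriv_le_seminorm ℂ 1 x) trivial trivial
    rw [norm_iteratedFDeriv_zero]
    calc _ ≤ |c| * SchwartzMap.seminorm ℂ 0 1 b * ‖ξ‖ := by
          rw [sub_zero, norm_smul, Real.norm_eq_abs] at mean_value
          linarith
      _ ≤ _ := by gcongr <;> linarith
  · have hsmooth : ContDiff ℝ j (fun ξ => b (c • ξ)) := (b.smooth j).comp (contDiff_const_smul c)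
    have hderiv : iteratedFDeriv ℝ j (fun ξ => b (c • ξ) - b 0) ξ =
        c ^ j • iteratedFDeriv ℝ j b (c • ξ) := by
      change iteratedFDeriv ℝ j ((fun ξ => b (c • ξ)) - fun _ => b 0) ξ = _
      rw [iteratedFDeriv_sub_apply hsmooth.contDiffAt contDiffAt_const,
        iteratedFDeriv_const_of_ne hj.ne', Pi.zero_apply, sub_zero,
        iteratedFDeriv_comp_const_smul c (b.smooth j)]
    rw [hderiv, norm_smul, norm_pow, Real.norm_eq_abs]
    calc _ ≤ |c| * (SchwartzMap.seminorm ℂ 0 j b + SchwartzMap.seminorm ℂ 0 1 b) := by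
          gcongr
          · exact pow_le_of_le_one (abs_nonneg c) hc hj.ne'
          · exact (b.norm_iteratedFDeriv_le_seminorm ℂ j _).trans (le_add_of_nonneg_right hb1)
      _ ≤ _ := le_mul_of_one_le_right (by positivity) (by simp)

lemma smulLeftCLM_add_smulLeftCLM_one_sub {b : E → ℂ} (hb : b.HasTemperateGrowth) (f : 𝓢(E, F)) :
    smulLeftCLM F b f + smulLeftCLM F (fun ξ => 1 - b ξ) f = f := by
  have hcompl : (fun ξ => 1 - b ξ).HasTemperateGrowth :=
    (Function.HasTemperateGrowth.const (1 : ℂ)).sub hb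
  ext ξ
  rw [add_apply, smulLeftCLM_apply_apply hb, smulLeftCLM_apply_apply hcompl, ← add_smul,
    add_sub_cancel, one_smul]

lemma hasTemperateGrowth_comp_smul {m : E → F} (hm : m.HasTemperateGrowth) (c : ℝ) :
    (fun ξ => m (c • ξ)).HasTemperateGrowth :=
  hm.comp (g := m) (f := fun ξ : E => c • ξ) (by fun_prop)

lemma tendsto_smulLeftCLM_comp_smul (b : 𝓢(E, ℂ)) (f : 𝓢(E, F)) :
    Tendsto (fun c : ℝ => smulLeftCLM F (fun ξ => b (c • ξ)) f) (𝓝 0) (𝓝 (b 0 • f)) := by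
  have hb : ∀ c : ℝ, (fun ξ => b (c • ξ)).HasTemperateGrowth :=
    hasTemperateGrowth_comp_smul b.hasTemperateGrowth
  have hb_sub : ∀ c : ℝ, (fun ξ => b (c • ξ) - b 0).HasTemperateGrowth := fun c =>
    (hb c).sub (.const (b 0))
  refine tendsto_nhds_of_seminorm_sub fun k l => ?_
  obtain ⟨C, -, hC⟩ := exists_seminorm_smulLeftCLM_le (SchwartzMap.seminorm ℂ k l)
    (continuous_seminorm k l) f 1
    (fun j => SchwartzMap.seminorm ℂ 0 j b + SchwartzMap.seminorm ℂ 0 1 b)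
  have hlim : Tendsto (fun c : ℝ => C * |c|) (𝓝 0) (𝓝 0) := by
    simpa using (continuous_abs.tendsto (0 : ℝ)).const_mul C
  refine squeeze_zero' (.of_forall fun c => apply_nonneg _ _) ?_ hlim
  filter_upwards [Metric.closedBall_mem_nhds (0 : ℝ) one_pos] with c hc
  have hsub : smulLeftCLM F (fun ξ => b (c • ξ)) f - b 0 • f =
      smulLeftCLM F (fun ξ => b (c • ξ) - b 0) f := by
    ext ξ
    simp only [sub_apply, smul_apply, smulLeftCLM_apply_apply (hb c),
      smulLeftCLM_apply_apply (hb_sub c), sub_smul]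
  rw [hsub]
  exact hC _ (hb_sub c) |c| (abs_nonneg c)
    (norm_iteratedFDeriv_comp_smul_sub_le b (by simpa using hc))

end Schwartz

section Dilation

variable {E F : Type*} [NormedAddCommGroup E] [NormedSpace ℝ E]
  [NormedAddCommGroup F] [NormedSpace ℂ F]

/-- The dilation `f ↦ f (c ·)` of Schwartz functions, with the value `0` at `c = 0`, where
`f (c ·)` is constant. -/
def dilation (c : ℝ) : 𝓢(E, F) →L[ℂ] 𝓢(E, F) :=
  if hc : c = 0 then 0 else
    compCLMOfContinuousLinearEquiv ℂ (ContinuousLinearEquiv.smulLeft (Units.mk0 c hc))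

/-- The dilation `f ↦ c ^ d f (c ·)`, where `d` is the dimension: it preserves the integral. -/
def normalizedDilation (c : ℝ) : 𝓢(E, F) →L[ℂ] 𝓢(E, F) :=
  (c : ℂ) ^ Module.finrank ℝ E • dilation c

lemma dilation_apply {c : ℝ} (hc : c ≠ 0) (f : 𝓢(E, F)) (x : E) : dilation c f x = f (c • x) := by
  simp only [dilation, hc, dite_false]
  rfl

lemma coe_dilation {c : ℝ} (hc : c ≠ 0) (f : 𝓢(E, F)) : ⇑(dilation c f) = fun x => f (c • x) :=
  funext (dilation_apply hc f)

lemma normalizedDilation_apply {c : ℝ} (hc : c ≠ 0) (f : 𝓢(E, F)) (x : E) :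
    normalizedDilation c f x = (c : ℂ) ^ Module.finrank ℝ E • f (c • x) := by
  rw [normalizedDilation, _root_.smul_apply, smul_apply, dilation_apply hc]

lemma hasCompactSupport_normalizedDilation {c : ℝ} (hc : c ≠ 0) {f : 𝓢(E, F)}
    (hf : HasCompactSupport f) : HasCompactSupport (normalizedDilation c f) := by
  rw [funext (normalizedDilation_apply hc f)]
  exact (hf.comp_smul hc).smul_left (f := fun _ => (c : ℂ) ^ Module.finrank ℝ E)

lemma seminorm_dilation_le {t : ℝ} (ht : 1 ≤ t) (k l : ℕ) (f : 𝓢(E, F)) :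
    SchwartzMap.seminorm ℂ k l (dilation t f) ≤ t ^ l * SchwartzMap.seminorm ℂ k l f := by
  have ht₀ : 0 < t := by linarith
  refine SchwartzMap.seminorm_le_bound ℂ k l _ (by positivity) fun x => ?_
  have hx : ‖x‖ ≤ ‖t • x‖ := by
    rw [norm_smul, Real.norm_of_nonneg ht₀.le]
    exact le_mul_of_one_le_left (norm_nonneg x) ht
  rw [coe_dilation ht₀.ne', iteratedFDeriv_comp_const_smul t (f.smooth l), norm_smul, norm_pow,
    Real.norm_of_nonneg ht₀.le]
  calc _ ≤ ‖t • x‖ ^ k * (t ^ l * ‖iteratedFDeriv ℝ l f (t • x)‖) := by gcongr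
    _ = t ^ l * (‖t • x‖ ^ k * ‖iteratedFDeriv ℝ l f (t • x)‖) := by ring
    _ ≤ _ := by gcongr; exact SchwartzMap.le_seminorm ℂ k l f (t • x)

lemma smulLeftCLM_dilation {c : ℝ} (hc : c ≠ 0) {m : E → ℂ} (hm : m.HasTemperateGrowth)
    (f : 𝓢(E, F)) :
    smulLeftCLM F m (dilation c f) =
      dilation c (smulLeftCLM F (fun ξ => m (c⁻¹ • ξ)) f) := by
  ext ξ
  rw [smulLeftCLM_apply_apply hm, dilation_apply hc, dilation_apply hc,
    smulLeftCLM_apply_apply (hasTemperateGrowth_comp_smul hm _), inv_smul_smul₀ hc]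

lemma smulLeftCLM_normalizedDilation {c : ℝ} (hc : c ≠ 0) {m : E → ℂ}
    (hm : m.HasTemperateGrowth) (f : 𝓢(E, F)) :
    smulLeftCLM F m (normalizedDilation c f) =
      normalizedDilation c (smulLeftCLM F (fun ξ => m (c⁻¹ • ξ)) f) := by
  rw [normalizedDilation, _root_.smul_apply, _root_.smul_apply, map_smul,
    smulLeftCLM_dilation hc hm]

lemma seminorm_smulLeftCLM_normalizedDilation_le (b : 𝓢(E, ℂ)) {r : ℝ} (hr : 0 < r)
    (hb : ∀ ξ, ‖ξ‖ < r → b ξ = 1) (K : 𝓢(E, F)) (k l : ℕ) :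
    ∃ C : ℝ, ∀ t : ℝ, 1 ≤ t → SchwartzMap.seminorm ℂ k l
      (smulLeftCLM F (fun ξ => 1 - b ξ) (normalizedDilation t K)) ≤ C * t⁻¹ := by
  set d := Module.finrank ℝ E
  have hb_bound : ∀ j ξ, ‖iteratedFDeriv ℝ j b ξ‖ ≤ SchwartzMap.seminorm ℂ 0 j b :=
    b.norm_iteratedFDeriv_le_seminorm ℂ
  obtain ⟨C, -, hC⟩ := exists_seminorm_smulLeftCLM_le_of_eq_zero (SchwartzMap.seminorm ℂ k l)
    (continuous_seminorm k l) K (d + l + 1) (fun j => ‖(1 : ℂ)‖ + SchwartzMap.seminorm ℂ 0 j b)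
  refine ⟨C * r⁻¹ ^ (d + l + 1), fun t ht => ?_⟩
  have ht₀ : 0 < t := by linarith
  have hcompl : (fun ξ => 1 - b ξ).HasTemperateGrowth :=
    (Function.HasTemperateGrowth.const (1 : ℂ)).sub b.hasTemperateGrowth
  have hbt : ∀ j ξ, ‖iteratedFDeriv ℝ j (fun ξ => 1 - b (t⁻¹ • ξ)) ξ‖ ≤
      ‖(1 : ℂ)‖ + SchwartzMap.seminorm ℂ 0 j b := by
    refine norm_iteratedFDeriv_const_sub_le ((b.smooth ⊤).comp (contDiff_const_smul _))
      (norm_iteratedFDeriv_comp_smul_le (b.smooth ⊤) hb_bound ?_) 1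
    rw [abs_of_pos (inv_pos.mpr ht₀)]
    exact inv_le_one_of_one_le₀ ht
  have hbt_zero : ∀ ξ, ‖ξ‖ < t * r → 1 - b (t⁻¹ • ξ) = 0 := fun ξ hξ => by
    rw [hb, sub_self]
    rwa [norm_smul, norm_inv, Real.norm_of_nonneg ht₀.le, inv_mul_lt_iff₀ ht₀]
  rw [smulLeftCLM_normalizedDilation ht₀.ne' hcompl, normalizedDilation, _root_.smul_apply,
    map_smul_eq_mul, norm_pow, Complex.norm_real, Real.norm_of_nonneg ht₀.le]
  calc _ ≤ t ^ d * (t ^ l * (C * (t * r)⁻¹ ^ (d + l + 1))) := by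
        gcongr
        refine (seminorm_dilation_le ht k l _).trans ?_
        gcongr
        exact hC _ (hasTemperateGrowth_comp_smul hcompl t⁻¹) (t * r) (by positivity) hbt hbt_zero
    _ = C * r⁻¹ ^ (d + l + 1) * t⁻¹ := by
        rw [mul_inv, mul_pow, show t⁻¹ ^ (d + l + 1) = (t ^ d * t ^ l * t)⁻¹ by
          rw [inv_pow, pow_succ, pow_add]]
        field_simp

lemma tendsto_smulLeftCLM_normalizedDilation (b : 𝓢(E, ℂ)) {r : ℝ} (hr : 0 < r)
    (hb : ∀ ξ, ‖ξ‖ < r → b ξ = 1) (K : 𝓢(E, F)) :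
    Tendsto (fun t => smulLeftCLM F (fun ξ => 1 - b ξ) (normalizedDilation t K)) atTop (𝓝 0) := by
  refine tendsto_nhds_of_seminorm_sub fun k l => ?_
  obtain ⟨C, hC⟩ := seminorm_smulLeftCLM_normalizedDilation_le b hr hb K k l
  simp only [sub_zero]
  refine squeeze_zero' (.of_forall fun t => apply_nonneg _ _)
    ((eventually_ge_atTop 1).mono hC) ?_
  simpa using tendsto_inv_atTop_zero.const_mul C

end Dilation

/-! ### Dilations, translations and the Fourier transform -/

section Fourier

variable {V F : Type*} [NormedAddCommGroup V] [InnerProductSpace ℝ V] [FiniteDimensional ℝ V]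
  [MeasurableSpace V] [BorelSpace V] [NormedAddCommGroup F] [NormedSpace ℂ F]

lemma pow_smul_integral_comp_smul {c : ℝ} (hc : 0 < c) (f : V → F) :
    (c : ℂ) ^ Module.finrank ℝ V • ∫ x, f (c • x) = ∫ x, f x := by
  rw [Measure.integral_comp_smul, abs_of_pos (by positivity), ← Complex.ofReal_pow,
    Complex.coe_smul, smul_inv_smul₀ (by positivity)]

lemma fourier_normalizedDilation {c : ℝ} (hc : 0 < c) (f : 𝓢(V, F)) :
    𝓕 (normalizedDilation c f) = dilation c⁻¹ (𝓕 f) := by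
  ext ξ
  rw [dilation_apply (inv_ne_zero hc.ne'), normalizedDilation, _root_.smul_apply,
    FourierTransform.fourier_smul, smul_apply, fourier_coe, fourier_coe, Real.fourier_eq,
    Real.fourier_eq, ← pow_smul_integral_comp_smul hc
      (fun v => Real.fourierChar (-inner ℝ v (c⁻¹ • ξ)) • f v)]
  congr! 3 with v
  rw [dilation_apply hc.ne', real_inner_smul_left, real_inner_smul_right,
    mul_inv_cancel_left₀ hc.ne']

lemma fourierInv_normalizedDilation {c : ℝ} (hc : 0 < c) (f : 𝓢(V, F)) :
    𝓕⁻ (normalizedDilation c f) = dilation c⁻¹ (𝓕⁻ f) := by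
  ext ξ
  rw [dilation_apply (inv_ne_zero hc.ne'), fourierInv_coe, fourierInv_coe,
    Real.fourierInv_eq_fourier_neg, Real.fourierInv_eq_fourier_neg, ← fourier_coe, ← fourier_coe,
    fourier_normalizedDilation hc, dilation_apply (inv_ne_zero hc.ne'), smul_neg]

lemma fourierInv_apply_zero (f : 𝓢(V, F)) : 𝓕⁻ f 0 = ∫ x, f x := by
  rw [fourierInv_coe, Real.fourierInv_eq]
  simp

lemma fourierInv_compSubConstCLM (x : V) (f : 𝓢(V, F)) (ξ : V) :
    𝓕⁻ (compSubConstCLM ℂ x f) ξ = Real.fourierChar (inner ℝ x ξ) • 𝓕⁻ f ξ := by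
  rw [fourierInv_coe, fourierInv_coe, Real.fourierInv_eq, Real.fourierInv_eq,
    ← integral_add_right_eq_self _ x, Circle.smul_def, ← integral_smul]
  congr! 2 with _
  rw [compSubConstCLM_apply, add_sub_cancel_right, inner_add_left, add_comm,
    AddChar.map_add_eq_mul, mul_smul, ← Circle.smul_def]

lemma fourier_eq_compSubConstCLM (x : V) {f g : 𝓢(V, F)}
    (h : ∀ ξ, g ξ = Real.fourierChar (inner ℝ x ξ) • f ξ) :
    𝓕 g = compSubConstCLM ℂ x (𝓕 f) := by
  ext y
  rw [compSubConstCLM_apply, fourier_coe, fourier_coe, Real.fourier_eq, Real.fourier_eq]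
  congr! 2 with v
  rw [h, ← mul_smul, ← AddChar.map_add_eq_mul, inner_sub_right, real_inner_comm x v]
  congr! 2
  ring

lemma fourier_smulLeftCLM_fourierInv_compSubConstCLM {m : V → ℂ} (hm : m.HasTemperateGrowth)
    (x : V) (f : 𝓢(V, F)) :
    𝓕 (smulLeftCLM F m (𝓕⁻ (compSubConstCLM ℂ x f))) =
      compSubConstCLM ℂ x (𝓕 (smulLeftCLM F m (𝓕⁻ f))) := by
  refine fourier_eq_compSubConstCLM x fun ξ => ?_
  rw [smulLeftCLM_apply_apply hm, smulLeftCLM_apply_apply hm, fourierInv_compSubConstCLM,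
    smul_comm]

variable [CompleteSpace F]

lemma fourier_dilation {c : ℝ} (hc : 0 < c) (f : 𝓢(V, F)) :
    𝓕 (dilation c f) = normalizedDilation c⁻¹ (𝓕 f) := by
  have h := fourierInv_normalizedDilation (inv_pos.mpr hc) (𝓕 f)
  rw [inv_inv, FourierTransform.fourierInv_fourier_eq] at h
  rw [← h, FourierTransform.fourier_fourierInv_eq]

lemma integral_fourier (m : 𝓢(V, F)) : ∫ x, 𝓕 m x = m 0 := by
  rw [← fourierInv_apply_zero, FourierTransform.fourierInv_fourier_eq]

lemma fourierMultiplierCLM_dilation {c : ℝ} (hc : 0 < c) {m : V → ℂ} (hm : m.HasTemperateGrowth)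
    (f : 𝓢(V, F)) :
    SchwartzMap.fourierMultiplierCLM F m (dilation c f) =
      dilation c (SchwartzMap.fourierMultiplierCLM F (fun ξ => m (c • ξ)) f) := by
  rw [SchwartzMap.fourierMultiplierCLM_apply, SchwartzMap.fourierMultiplierCLM_apply,
    fourier_dilation hc, smulLeftCLM_normalizedDilation (inv_ne_zero hc.ne') hm,
    fourierInv_normalizedDilation (inv_pos.mpr hc), inv_inv]

end Fourier

/-! ### Compactly supported Schwartz functions -/

section Bump

variable {E : Type*} [NormedAddCommGroup E] [NormedSpace ℝ E] [HasContDiffBump E]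

/-- The bump function at the origin with radii `t⁻¹` and `2 t⁻¹`. -/
def originBump (t : ℝ) (ht : 0 < t) : ContDiffBump (0 : E) :=
  ⟨t⁻¹, 2 * t⁻¹, inv_pos.mpr ht, by linarith [inv_pos.mpr ht]⟩

lemma originBump_apply {t : ℝ} (ht : 0 < t) (x : E) :
    (originBump t ht : ContDiffBump (0 : E)) x =
      (originBump 1 one_pos : ContDiffBump (0 : E)) (t • x) := by
  have : 2 * t⁻¹ * t = 2 := by field_simp
  simp [originBump, ContDiffBump.apply, this]

variable [FiniteDimensional ℝ E]

/-- A bump function, as a complex-valued Schwartz function. -/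
def bumpSchwartz {c : E} (β : ContDiffBump c) : 𝓢(E, ℂ) :=
  (β.hasCompactSupport.comp_left (g := ((↑) : ℝ → ℂ)) Complex.ofReal_zero).toSchwartzMap
    (Complex.ofRealCLM.contDiff.comp β.contDiff)

lemma bumpSchwartz_apply {c : E} (β : ContDiffBump c) (x : E) : bumpSchwartz β x = β x := rfl

lemma hasCompactSupport_bumpSchwartz {c : E} (β : ContDiffBump c) :
    HasCompactSupport (bumpSchwartz β) :=
  β.hasCompactSupport.comp_left (g := ((↑) : ℝ → ℂ)) Complex.ofReal_zero

lemma exists_cutoff {r : ℝ} (hr : 0 < r) :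
    ∃ b : 𝓢(E, ℂ), HasCompactSupport b ∧ (∀ ξ, ‖ξ‖ < r → b ξ = 1) ∧
      (∀ ξ, 2 * r ≤ ‖ξ‖ → b ξ = 0) ∧ ∀ ξ, ‖b ξ‖ ≤ 1 := by
  let β : ContDiffBump (0 : E) := originBump r⁻¹ (inv_pos.mpr hr)
  refine ⟨bumpSchwartz β, hasCompactSupport_bumpSchwartz β, fun ξ hξ => ?_, fun ξ hξ => ?_,
    fun ξ => ?_⟩
  · rw [bumpSchwartz_apply, β.one_of_mem_closedBall (by simpa [β, originBump] using hξ.le),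
      Complex.ofReal_one]
  · rw [bumpSchwartz_apply, β.zero_of_le_dist (by simpa [β, originBump] using hξ),
      Complex.ofReal_zero]
  · rw [bumpSchwartz_apply, Complex.norm_real, Real.norm_of_nonneg β.nonneg]
    exact β.le_one

lemma eq_of_eq_of_hasCompactSupport {F T : Type*} [NormedAddCommGroup F] [NormedSpace ℂ F]
    [TopologicalSpace T] [T2Space T] {A B : 𝓢(E, F) → T} (hA : Continuous A) (hB : Continuous B)
    (h : ∀ g : 𝓢(E, F), HasCompactSupport g → A g = B g) : A = B := by
  funext f
  let b : 𝓢(E, ℂ) := bumpSchwartz (originBump 1 one_pos)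
  have hb₀ : b 0 = 1 := by
    rw [bumpSchwartz_apply, ContDiffBump.one_of_mem_closedBall _ (by simp [originBump]),
      Complex.ofReal_one]
  have hlim : Tendsto (fun c : ℝ => smulLeftCLM F (fun ξ => b (c • ξ)) f) (𝓝[>] 0) (𝓝 f) := by
    simpa only [hb₀, one_smul] using
      (tendsto_smulLeftCLM_comp_smul b f).mono_left nhdsWithin_le_nhds
  refine tendsto_nhds_unique ((hA.tendsto f).comp hlim)
    (((hB.tendsto f).comp hlim).congr' ?_)
  filter_upwards [self_mem_nhdsWithin] with c hc
  refine (h _ ?_).symm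
  rw [smulLeftCLM_apply (hasTemperateGrowth_comp_smul b.hasTemperateGrowth _)]
  exact ((hasCompactSupport_bumpSchwartz _).comp_smul (ne_of_gt hc)).smul_right

end Bump

section Mollifier

variable {V : Type*} [NormedAddCommGroup V] [InnerProductSpace ℝ V] [FiniteDimensional ℝ V]
  [MeasurableSpace V] [BorelSpace V]

/-- A compactly supported Schwartz function with integral `1`; its normalized dilations are the
normalizations of the bump functions `originBump t`. -/
def mollifier : 𝓢(V, ℂ) :=
  (∫ x, bumpSchwartz (originBump 1 one_pos : ContDiffBump (0 : V)) x)⁻¹ •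
    bumpSchwartz (originBump 1 one_pos)

lemma integral_bumpSchwartz {c : V} (β : ContDiffBump c) :
    ∫ x, bumpSchwartz β x = ((∫ x, β x : ℝ) : ℂ) :=
  integral_ofReal

lemma integral_mollifier : ∫ x, (mollifier : 𝓢(V, ℂ)) x = 1 := by
  simp only [mollifier, smul_apply]
  rw [integral_smul, smul_eq_mul, inv_mul_cancel₀]
  rw [integral_bumpSchwartz]
  exact_mod_cast (originBump 1 one_pos).integral_pos.ne'

lemma hasCompactSupport_mollifier : HasCompactSupport (mollifier : 𝓢(V, ℂ)) :=
  (hasCompactSupport_bumpSchwartz _).smul_left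

lemma ofReal_normed_originBump {t : ℝ} (ht : 0 < t) (x : V) :
    (((originBump t ht : ContDiffBump (0 : V)).normed volume x : ℝ) : ℂ) =
      normalizedDilation t mollifier x := by
  set I : ℝ := ∫ x, (originBump 1 one_pos : ContDiffBump (0 : V)) x with hI
  have hmass : ∫ x, (originBump t ht : ContDiffBump (0 : V)) x =
      (t ^ Module.finrank ℝ V)⁻¹ * I := by
    simp only [originBump_apply ht]
    rw [Measure.integral_comp_smul, abs_of_pos (by positivity), smul_eq_mul]
  rw [ContDiffBump.normed_def, hmass, originBump_apply ht, normalizedDilation_apply ht.ne',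
    mollifier, smul_apply, integral_bumpSchwartz, bumpSchwartz_apply, ← hI]
  push_cast
  rw [div_eq_mul_inv, mul_inv, inv_inv, smul_eq_mul, smul_eq_mul]
  ring

lemma tendsto_smulLeftCLM_fourierInv_normalizedDilation (m f : 𝓢(V, ℂ)) :
    Tendsto (fun t : ℝ => smulLeftCLM ℂ m (𝓕⁻ (normalizedDilation t f))) atTop
      (𝓝 ((∫ x, f x) • m)) := by
  have hlim := (tendsto_smulLeftCLM_comp_smul (𝓕⁻ f) m).comp tendsto_inv_atTop_zero
  rw [fourierInv_apply_zero] at hlim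
  refine hlim.congr' ?_
  filter_upwards [eventually_gt_atTop 0] with t ht
  ext ξ
  rw [Function.comp_apply, fourierInv_normalizedDilation ht,
    smulLeftCLM_apply_apply m.hasTemperateGrowth, dilation_apply (inv_ne_zero ht.ne'),
    smulLeftCLM_apply_apply (hasTemperateGrowth_comp_smul (𝓕⁻ f).hasTemperateGrowth _),
    smul_eq_mul, smul_eq_mul, mul_comm]

end Mollifier

/-! ### Locally integrable functions as tempered distributions -/

section Represents

variable {n : ℕ} {g : Rn n → ℂ} {v : 𝓢'(Rn n, ℂ)}

lemma Represents.apply_normalizedDilation (hv : Represents g v) {w : 𝓢'(Rn n, ℂ)} {t : ℝ}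
    (ht : 0 < t) (hw : Represents (fun x => g (t⁻¹ • x)) w) (ψ : 𝓢(Rn n, ℂ)) :
    v (normalizedDilation t ψ) = w ψ := by
  refine congrFun (eq_of_eq_of_hasCompactSupport (A := fun ψ => v (normalizedDilation t ψ))
    (B := fun ψ => w ψ) ((map_continuous v).comp (normalizedDilation t).continuous)
    (map_continuous w) fun h hh => ?_) ψ
  rw [hw.2 h hh, hv.2 _ (hasCompactSupport_normalizedDilation ht.ne' hh),
    ← pow_smul_integral_comp_smul ht (fun x => h x * g (t⁻¹ • x)), ← integral_smul]
  congr 1 with x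
  rw [normalizedDilation_apply ht.ne', inv_smul_smul₀ ht.ne', smul_mul_assoc]

lemma Represents.apply_compSubConstCLM (hv : Represents g v) {h : 𝓢(Rn n, ℂ)}
    (hh : HasCompactSupport h) (x : Rn n) :
    v (compSubConstCLM ℂ x h) = ∫ y, h (y - x) * g y :=
  hv.2 _ (hh.comp_homeomorph (Homeomorph.subRight x))

lemma normed_originBump_convolution {m : 𝓢(Rn n, ℂ)} {u : 𝓢'(Rn n, ℂ)}
    (hg : Represents g (TemperedDistribution.fourierMultiplierCLM ℂ m u)) {t : ℝ} (ht : 0 < t)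
    (x : Rn n) :
    (((originBump t ht).normed volume ⋆[ContinuousLinearMap.lsmul ℝ ℝ, volume] g) x) =
      u (compSubConstCLM ℂ x
        (𝓕 (smulLeftCLM ℂ m (𝓕⁻ (normalizedDilation t mollifier : 𝓢(Rn n, ℂ)))))) := by
  rw [← fourier_smulLeftCLM_fourierInv_compSubConstCLM (m := m) m.hasTemperateGrowth,
    ← TemperedDistribution.fourierMultiplierCLM_apply_apply, hg.apply_compSubConstCLM
      (hasCompactSupport_normalizedDilation ht.ne' hasCompactSupport_mollifier),
    convolution_eq_swap]
  congr 1 with y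
  rw [← ofReal_normed_originBump ht, ContinuousLinearMap.lsmul_apply, Complex.real_smul,
    ← ContDiffBump.normed_neg, neg_sub]

/- By Lebesgue differentiation, almost every value of `g` is the limit of its mollifications,
and these are values of `u` at Schwartz functions that converge to a translate of `𝓕 m`. -/
theorem ae_eq_apply_compSubConstCLM_fourier {m : 𝓢(Rn n, ℂ)} {u : 𝓢'(Rn n, ℂ)}
    (hg : Represents g (TemperedDistribution.fourierMultiplierCLM ℂ m u)) :
    ∀ᵐ x, g x = u (compSubConstCLM ℂ x (𝓕 m)) := by
  have hpos : ∀ N : ℕ, (0 : ℝ) < (N : ℝ) + 1 := fun N => by positivity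
  have hscale : Tendsto (fun N : ℕ => (N : ℝ) + 1) atTop atTop :=
    tendsto_atTop_add_const_right _ _ tendsto_natCast_atTop_atTop
  have hradius : Tendsto (fun N => (originBump _ (hpos N) : ContDiffBump (0 : Rn n)).rOut)
      atTop (𝓝 0) := by
    simpa [originBump] using (tendsto_inv_atTop_zero.comp hscale).const_mul 2
  filter_upwards [ContDiffBump.ae_convolution_tendsto_right_of_locallyIntegrable (K := 2) hradius
    (.of_forall fun N => le_rfl) hg.1] with x hx
  refine tendsto_nhds_unique hx ?_
  simp_rw [normed_originBump_convolution hg (hpos _)]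
  have hcont : Continuous fun ψ : 𝓢(Rn n, ℂ) => u (compSubConstCLM ℂ x (𝓕 ψ)) :=
    (map_continuous u).comp ((compSubConstCLM ℂ x).continuous.comp
      (FourierTransform.continuous_fourier (E := 𝓢(Rn n, ℂ))))
  have hlim := (tendsto_smulLeftCLM_fourierInv_normalizedDilation m mollifier).comp hscale
  rw [integral_mollifier, one_smul] at hlim
  exact (hcont.tendsto m).comp hlim

end Represents

section HaarMeasure

variable {E : Type*} [NormedAddCommGroup E] [NormedSpace ℝ E] [FiniteDimensional ℝ E]
  [MeasurableSpace E] [BorelSpace E] (μ : Measure E) [μ.IsAddHaarMeasure]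

lemma tendsto_integral_comp_add_inv_smul_mul {G K : E → ℂ} {x : E} {B : ℝ}
    (hG : AEStronglyMeasurable G μ) (hB : ∀ y, ‖G y‖ ≤ B) (hGx : ContinuousAt G x)
    (hK : Integrable K μ) :
    Tendsto (fun t : ℝ => ∫ z, G (x + t⁻¹ • z) * K z ∂μ) atTop (𝓝 (G x * ∫ z, K z ∂μ)) := by
  rw [← integral_const_mul]
  refine tendsto_integral_filter_of_dominated_convergence (fun z => B * ‖K z‖) ?_
    (.of_forall fun t => .of_forall fun z => ?_) (hK.norm.const_mul B) (.of_forall fun z => ?_)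
  · filter_upwards [eventually_gt_atTop 0] with t ht
    exact (hG.comp_quasiMeasurePreserving
      ((measurePreserving_add_left μ x).quasiMeasurePreserving.comp
        (Measure.quasiMeasurePreserving_smul μ (inv_ne_zero ht.ne')))).mul
      hK.aestronglyMeasurable
  · rw [norm_mul]
    gcongr
    exact hB _
  · have harg : Tendsto (fun t : ℝ => x + t⁻¹ • z) atTop (𝓝 x) := by
      simpa using ((tendsto_inv_atTop_zero (𝕜 := ℝ)).smul_const z).const_add x
    exact (hGx.tendsto.comp harg).mul_const _

end HaarMeasure

section DilationFactor

variable {n : ℕ} {p : ℝ≥0∞} {t : ℝ}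

/-- The factor `t ^ (-n / p)`: multiplication by it makes the dilation `f ↦ f (t⁻¹ •)` of functions
on `ℝⁿ` isometric for the `L^p` norm. -/
def dilationFactor (n : ℕ) (p : ℝ≥0∞) (t : ℝ) : ℝ≥0∞ :=
  ENNReal.ofReal (t ^ n)⁻¹ ^ (1 / p).toReal

lemma dilationFactor_ne_zero (ht : 0 < t) : dilationFactor n p t ≠ 0 := by
  have : 0 < ENNReal.ofReal (t ^ n)⁻¹ := ENNReal.ofReal_pos.mpr (by positivity)
  exact (ENNReal.rpow_pos this ENNReal.ofReal_ne_top).ne'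

lemma dilationFactor_ne_top : dilationFactor n p t ≠ ⊤ :=
  ENNReal.rpow_ne_top_of_nonneg ENNReal.toReal_nonneg ENNReal.ofReal_ne_top

lemma eLpNorm_comp_smul {F : Type*} [NormedAddCommGroup F] (ht : 0 < t) (f : Rn n → F) :
    eLpNorm (fun x => f (t • x)) p = dilationFactor n p t * eLpNorm f p := by
  rw [← Function.comp_def f, ← (measurableEmbedding_const_smul₀ ht.ne').eLpNorm_map_measure,
    Measure.map_addHaar_smul _ ht.ne', finrank_euclideanSpace_fin, abs_of_pos (by positivity),
    eLpNorm_smul_measure_of_ne_zero (by positivity), smul_eq_mul, dilationFactor]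

lemma dilationFactor_mul_eLpNorm_comp_inv_smul {F : Type*} [NormedAddCommGroup F] (ht : 0 < t)
    (f : Rn n → F) :
    dilationFactor n p t * eLpNorm (fun x => f (t⁻¹ • x)) p = eLpNorm f p := by
  rw [← eLpNorm_comp_smul ht fun x => f (t⁻¹ • x)]
  simp only [inv_smul_smul₀ ht.ne']

end DilationFactor

section Values

variable {n : ℕ} {g : Rn n → ℂ} {v : 𝓢'(Rn n, ℂ)}

lemma Represents.apply_compSubConstCLM_cutoff (hv : Represents g v) {b : 𝓢(Rn n, ℂ)}
    (hb : HasCompactSupport b) (K : 𝓢(Rn n, ℂ)) {t : ℝ} (ht : 0 < t) (x : Rn n) :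
    v (compSubConstCLM ℂ x (smulLeftCLM ℂ b (normalizedDilation t K))) =
      ∫ z, b (x + t⁻¹ • z - x) * g (x + t⁻¹ • z) * K z := by
  rw [hv.apply_compSubConstCLM, ← integral_add_left_eq_self _ x,
    ← pow_smul_integral_comp_smul ht (fun z => b (x + t⁻¹ • z - x) * g (x + t⁻¹ • z) * K z),
    ← integral_smul]
  · congr 1 with z
    rw [smulLeftCLM_apply_apply b.hasTemperateGrowth, add_sub_cancel_left, add_sub_cancel_left,
      normalizedDilation_apply ht.ne', inv_smul_smul₀ ht.ne']
    simp only [smul_eq_mul]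
    ring
  · rw [smulLeftCLM_apply b.hasTemperateGrowth]
    exact hb.smul_right

/- Near `x` the kernels `t ^ n K (t ·)` form an approximate identity; their tails tend to zero in
the Schwartz space, which absorbs the growth of `g`. -/
theorem Represents.tendsto_apply_compSubConstCLM_normalizedDilation (hv : Represents g v)
    {x : Rn n} (hx : ContinuousAt g x) (K : 𝓢(Rn n, ℂ)) :
    Tendsto (fun t => v (compSubConstCLM ℂ x (normalizedDilation t K))) atTop
      (𝓝 (g x * ∫ z, K z)) := by
  obtain ⟨ε, hε, hgε⟩ := Metric.eventually_nhds_iff.mp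
    (hx.norm.tendsto.eventually_le_const (lt_add_one ‖g x‖))
  obtain ⟨b, hb_supp, hb_one, hb_zero, hb_le⟩ := exists_cutoff (E := Rn n) (half_pos hε)
  have hbx : Continuous fun y => b (y - x) := b.continuous.comp (continuous_sub_right x)
  have hbound : ∀ y, ‖b (y - x) * g y‖ ≤ ‖g x‖ + 1 := by
    intro y
    by_cases hy : dist y x < ε
    · rw [norm_mul]
      exact (mul_le_of_le_one_left (norm_nonneg _) (hb_le _)).trans (hgε hy)
    · rw [hb_zero _ (by rw [← dist_eq_norm]; linarith), zero_mul, norm_zero]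
      positivity
  have hnear : Tendsto
      (fun t => v (compSubConstCLM ℂ x (smulLeftCLM ℂ b (normalizedDilation t K)))) atTop
      (𝓝 (g x * ∫ z, K z)) := by
    have hlim := tendsto_integral_comp_add_inv_smul_mul volume
      (hbx.aestronglyMeasurable.mul hv.1.aestronglyMeasurable) hbound (hbx.continuousAt.mul hx)
      K.integrable
    rw [Pi.mul_apply, sub_self, hb_one 0 (by simpa using hε), one_mul] at hlim
    refine hlim.congr' ?_
    filter_upwards [eventually_gt_atTop 0] with t ht
    exact (hv.apply_compSubConstCLM_cutoff hb_supp K ht x).symm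
  have htail : Tendsto (fun t => v (compSubConstCLM ℂ x
      (smulLeftCLM ℂ (fun ξ => 1 - b ξ) (normalizedDilation t K)))) atTop (𝓝 0) := by
    have hcont : Continuous fun ψ => v (compSubConstCLM ℂ x ψ) :=
      (map_continuous v).comp (compSubConstCLM ℂ x).continuous
    simpa only [map_zero, Function.comp_def] using (hcont.tendsto 0).comp
      (tendsto_smulLeftCLM_normalizedDilation b (half_pos hε) hb_one K)
  simpa only [← map_add, smulLeftCLM_add_smulLeftCLM_one_sub b.hasTemperateGrowth, add_zero]
    using hnear.add htail

lemma compSubConstCLM_normalizedDilation_comm {c : ℝ} (hc : c ≠ 0) (x : Rn n) (K : 𝓢(Rn n, ℂ)) :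
    normalizedDilation c (compSubConstCLM ℂ (c • x) K) =
      compSubConstCLM ℂ x (normalizedDilation c K) := by
  ext y
  rw [normalizedDilation_apply hc, compSubConstCLM_apply, compSubConstCLM_apply,
    normalizedDilation_apply hc, smul_sub]

lemma Represents.ae_eq_apply_normalizedDilation_fourier (hv : Represents g v)
    {m : 𝓢(Rn n, ℂ)} {t : ℝ} (ht : 0 < t) {w : 𝓢'(Rn n, ℂ)}
    (hw : Represents (fun x => g (t⁻¹ • x)) w) {G : Rn n → ℂ}
    (hG : Represents G (TemperedDistribution.fourierMultiplierCLM ℂ m w)) :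
    ∀ᵐ x, G (t • x) = v (compSubConstCLM ℂ x (normalizedDilation t (𝓕 m))) := by
  filter_upwards [(Measure.quasiMeasurePreserving_smul volume ht.ne').ae
    (ae_eq_apply_compSubConstCLM_fourier hG)] with x hx
  rw [hx, ← hv.apply_normalizedDilation ht hw, compSubConstCLM_normalizedDilation_comm ht.ne']

lemma distLpNorm_ne_top_iff {p : ℝ≥0∞} {u : 𝓢'(Rn n, ℂ)} :
    distLpNorm p u ≠ ⊤ ↔ ∃ G, Represents G u ∧ eLpNorm G p ≠ ⊤ := by
  simp [distLpNorm]

lemma Represents.aestronglyMeasurable_apply_normalizedDilation_fourier (hv : Represents g v)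
    {m : 𝓢(Rn n, ℂ)} {t : ℝ} (ht : 0 < t) {w : 𝓢'(Rn n, ℂ)}
    (hw : Represents (fun x => g (t⁻¹ • x)) w) {G : Rn n → ℂ}
    (hG : Represents G (TemperedDistribution.fourierMultiplierCLM ℂ m w)) :
    AEStronglyMeasurable fun x => v (compSubConstCLM ℂ x (normalizedDilation t (𝓕 m))) :=
  (hG.1.aestronglyMeasurable.comp_quasiMeasurePreserving
    (Measure.quasiMeasurePreserving_smul volume ht.ne')).congr
    (hv.ae_eq_apply_normalizedDilation_fourier ht hw hG)

lemma Represents.eLpNorm_apply_normalizedDilation_fourier_le (hv : Represents g v)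
    {m : 𝓢(Rn n, ℂ)} {t : ℝ} (ht : 0 < t) {w : 𝓢'(Rn n, ℂ)}
    (hw : Represents (fun x => g (t⁻¹ • x)) w) (p : ℝ≥0∞) :
    eLpNorm (fun x => v (compSubConstCLM ℂ x (normalizedDilation t (𝓕 m)))) p ≤
      dilationFactor n p t * distLpNorm p (TemperedDistribution.fourierMultiplierCLM ℂ m w) := by
  simp_rw [distLpNorm,
    ENNReal.mul_iInf_of_ne (dilationFactor_ne_zero ht) (dilationFactor_ne_top (n := n))]
  refine le_iInf₂ fun G hG => ?_
  rw [← eLpNorm_congr_ae (hv.ae_eq_apply_normalizedDilation_fourier ht hw hG),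
    eLpNorm_comp_smul ht]

/- Dilating `g` moves it to low frequencies, where `m = 1`: hence the low frequency parts of the
dilates, rescaled, converge to `g`, and Fatou's lemma applies. -/
theorem Represents.eLpNorm_le_liminf (hv : Represents g v) (hg : ∀ᵐ x, ContinuousAt g x)
    {m : 𝓢(Rn n, ℂ)} (hm : m 0 = 1) {w : ℝ → 𝓢'(Rn n, ℂ)}
    (hw : ∀ᶠ t in atTop, Represents (fun x => g (t⁻¹ • x)) (w t)) (p : ℝ≥0∞) :
    eLpNorm g p ≤ liminf (fun t => dilationFactor n p t *
      distLpNorm p (TemperedDistribution.fourierMultiplierCLM ℂ m (w t))) atTop := by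
  refine le_of_forall_gt_imp_ge_of_dense fun B hB => ?_
  obtain ⟨t, ht_lim, ht⟩ := exists_seq_forall_of_frequently
    ((frequently_lt_of_liminf_lt (by isBoundedDefault) hB).and_eventually
      (hw.and (eventually_gt_atTop 0)))
  choose hlt hwt hpos using ht
  let V (N : ℕ) (x : Rn n) : ℂ := v (compSubConstCLM ℂ x (normalizedDilation (t N) (𝓕 m)))
  have hV_le : ∀ N, eLpNorm (V N) p ≤ B := fun N =>
    (hv.eLpNorm_apply_normalizedDilation_fourier_le (hpos N) (hwt N) p).trans (hlt N).le
  have hV_meas : ∀ N, AEStronglyMeasurable (V N) := by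
    intro N
    obtain ⟨G, hG, -⟩ := distLpNorm_ne_top_iff.mp
      (ENNReal.lt_top_of_mul_ne_top_right (hlt N).ne_top (dilationFactor_ne_zero (hpos N))).ne
    exact hv.aestronglyMeasurable_apply_normalizedDilation_fourier (hpos N) (hwt N) hG
  have hV_lim : ∀ᵐ x, Tendsto (fun N => V N x) atTop (𝓝 (g x)) := by
    filter_upwards [hg] with x hx
    simpa only [integral_fourier, hm, mul_one, Function.comp_def] using
      (hv.tendsto_apply_compSubConstCLM_normalizedDilation hx (𝓕 m)).comp ht_lim
  refine (Lp.eLpNorm_lim_le_liminf_eLpNorm hV_meas g hV_lim).trans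
    (liminf_le_of_le (by isBoundedDefault) fun _ hb => ?_)
  obtain ⟨N, hN⟩ := hb.exists
  exact hN.trans (hV_le N)

end Values

section HighFrequencies

variable {V F : Type*} [NormedAddCommGroup V] [InnerProductSpace ℝ V] [FiniteDimensional ℝ V]
  [MeasurableSpace V] [BorelSpace V] [NormedAddCommGroup F] [NormedSpace ℂ F]

lemma exists_norm_fourierMultiplierCLM_le (f : 𝓢(V, F)) (M P : ℕ) (K : ℕ → ℝ) :
    ∃ C : ℝ, 0 ≤ C ∧ ∀ μ : V → ℂ, μ.HasTemperateGrowth → ∀ ρ : ℝ, 0 < ρ →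
      (∀ j ξ, ‖iteratedFDeriv ℝ j μ ξ‖ ≤ K j) → (∀ ξ, ‖ξ‖ < ρ → μ ξ = 0) → ∀ x,
      ‖SchwartzMap.fourierMultiplierCLM F μ f x‖ ≤ C * ρ⁻¹ ^ P * (1 + ‖x‖) ^ (-M : ℝ) := by
  let Q : Seminorm ℂ 𝓢(V, F) :=
    (Finset.Iic (M, 0)).sup fun m : ℕ × ℕ => SchwartzMap.seminorm ℂ m.1 m.2
  have hQ : Continuous Q :=
    Seminorm.continuous_finsetSup fun m _ => continuous_seminorm m.1 m.2
  let L := FourierTransform.fourierInvCLM ℂ 𝓢(V, F)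
  obtain ⟨C, hC₀, hC⟩ := exists_seminorm_smulLeftCLM_le_of_eq_zero (Q.comp L.toLinearMap)
    (hQ.comp L.continuous) (𝓕 f) P K
  refine ⟨2 ^ M * C, by positivity, fun μ hμ ρ hρ hK hμ_zero x => ?_⟩
  have hdecay := one_add_le_sup_seminorm_apply (𝕜 := ℂ) (m := (M, 0)) le_rfl le_rfl
    (SchwartzMap.fourierMultiplierCLM F μ f) x
  rw [norm_iteratedFDeriv_zero] at hdecay
  rw [Real.rpow_neg (by positivity), Real.rpow_natCast, ← div_eq_mul_inv,
    le_div_iff₀' (by positivity), mul_assoc]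
  refine hdecay.trans ?_
  gcongr
  exact hC μ hμ ρ hρ hK hμ_zero

variable [CompleteSpace F]

lemma fourierMultiplierCLM_add_fourierMultiplierCLM_one_sub {m : V → ℂ}
    (hm : m.HasTemperateGrowth) (f : 𝓢(V, F)) :
    SchwartzMap.fourierMultiplierCLM F m f + SchwartzMap.fourierMultiplierCLM F (fun ξ => 1 - m ξ) f
      = f := by
  rw [SchwartzMap.fourierMultiplierCLM_apply, SchwartzMap.fourierMultiplierCLM_apply,
    ← FourierTransform.fourierInv_add, smulLeftCLM_add_smulLeftCLM_one_sub hm,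
    FourierTransform.fourierInv_fourier_eq]

lemma exists_norm_fourierMultiplierCLM_dilation_le (f : 𝓢(V, F)) (M : ℕ) {P : ℕ} (hP : P ≠ 0)
    (K : ℕ → ℝ) :
    ∃ C : ℝ, 0 ≤ C ∧ ∀ μ : V → ℂ, μ.HasTemperateGrowth → ∀ ρ : ℝ, 0 < ρ →
      (∀ j ξ, ‖iteratedFDeriv ℝ j μ ξ‖ ≤ K j) → (∀ ξ, ‖ξ‖ < ρ → μ ξ = 0) →
      ∀ t : ℝ, 1 ≤ t → ∀ x, ‖SchwartzMap.fourierMultiplierCLM F μ (dilation t⁻¹ f) x‖ ≤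
        ρ⁻¹ ^ P * (C * t⁻¹ * (1 + ‖t⁻¹ • x‖) ^ (-M : ℝ)) := by
  obtain ⟨C, hC₀, hC⟩ := exists_norm_fourierMultiplierCLM_le f M P K
  refine ⟨C, hC₀, fun μ hμ ρ hρ hK hμ_zero t ht x => ?_⟩
  have ht₀ : 0 < t := by positivity
  have ht_inv : t⁻¹ ≤ 1 := inv_le_one_of_one_le₀ ht
  have hK_dilated := norm_iteratedFDeriv_comp_smul_le hμ.1 hK (c := t⁻¹)
    (by rwa [abs_of_pos (inv_pos.mpr ht₀)])
  have hzero_dilated (ξ : V) (hξ : ‖ξ‖ < t * ρ) : μ (t⁻¹ • ξ) = 0 := by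
    refine hμ_zero _ ?_
    rwa [norm_smul, norm_inv, Real.norm_of_nonneg ht₀.le, inv_mul_lt_iff₀ ht₀]
  rw [fourierMultiplierCLM_dilation (inv_pos.mpr ht₀) hμ, dilation_apply (inv_ne_zero ht₀.ne')]
  refine (hC _ (hasTemperateGrowth_comp_smul hμ t⁻¹) (t * ρ) (by positivity) hK_dilated
    hzero_dilated _).trans ?_
  calc C * (t * ρ)⁻¹ ^ P * (1 + ‖t⁻¹ • x‖) ^ (-M : ℝ)
      = ρ⁻¹ ^ P * (C * t⁻¹ ^ P * (1 + ‖t⁻¹ • x‖) ^ (-M : ℝ)) := by rw [mul_inv, mul_pow]; ring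
    _ ≤ _ := by
        gcongr ρ⁻¹ ^ P * (C * ?_ * _)
        exact pow_le_of_le_one (by positivity) ht_inv hP

end HighFrequencies

section SymbolFamilies

variable {n : ℕ} {ι : Type} {i₀ : ι} {m : ι → Rn n → ℂ} {ρ : ι → ℝ}

/-- Symbols of a decomposition of frequency space into the low frequencies, selected by `m i₀`, and
pieces `m i` that only see the frequencies `‖ξ‖ ≥ ρ i`. It covers the dyadic and the uniform
decompositions alike; `ρ i₀` is the radius of a ball on which `m i₀ = 1`. -/
structure IsSymbolFamily (i₀ : ι) (m : ι → Rn n → ℂ) (ρ : ι → ℝ) : Prop where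
  contDiff : ∀ i, ContDiff ℝ ∞ (m i)
  hasCompactSupport : ∀ i, HasCompactSupport (m i)
  exists_bound : ∃ K : ℕ → ℝ, ∀ i j ξ, ‖iteratedFDeriv ℝ j (m i) ξ‖ ≤ K j
  pos : ∀ i, 0 < ρ i
  le_one : ρ i₀ ≤ 1
  eq_zero : ∀ i, i ≠ i₀ → ∀ ξ, ‖ξ‖ < ρ i → m i ξ = 0
  eq_one : ∀ ξ, ‖ξ‖ < ρ i₀ → m i₀ ξ = 1

lemma IsSymbolFamily.hasTemperateGrowth (hm : IsSymbolFamily i₀ m ρ) (i : ι) :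
    (m i).HasTemperateGrowth :=
  ((hm.hasCompactSupport i).toSchwartzMap (hm.contDiff i)).hasTemperateGrowth

/-- `|f|` plus a small multiple `ε` of a rapidly decaying function: the size of the frequency pieces
of a dilate of `f`, up to rescaling. -/
def envelope {n : ℕ} (f : Rn n → ℂ) (M : ℕ) (ε : ℝ) (y : Rn n) : ℝ :=
  ‖f y‖ + ε * (1 + ‖y‖) ^ (-M : ℝ)

lemma envelope_nonneg (f : Rn n → ℂ) (M : ℕ) {ε : ℝ} (hε : 0 ≤ ε) (y : Rn n) :
    0 ≤ envelope f M ε y := by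
  unfold envelope
  positivity

lemma envelope_mono (f : Rn n → ℂ) (M : ℕ) (y : Rn n) : Monotone fun ε => envelope f M ε y := by
  intro ε₁ ε₂ h
  unfold envelope
  dsimp only
  gcongr

lemma IsSymbolFamily.exists_norm_high_le (hm : IsSymbolFamily i₀ m ρ) (f : 𝓢(Rn n, ℂ)) (M : ℕ)
    {P : ℕ} (hP : P ≠ 0) :
    ∃ e : ℝ, 0 ≤ e ∧ ∀ t : ℝ, 1 ≤ t → ∀ i, i ≠ i₀ → ∀ x,
      ‖SchwartzMap.fourierMultiplierCLM ℂ (m i) (dilation t⁻¹ f) x‖ ≤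
        (ρ i)⁻¹ ^ P * envelope f M (e * t⁻¹) (t⁻¹ • x) := by
  obtain ⟨K, hK⟩ := hm.exists_bound
  obtain ⟨e, he₀, he⟩ := exists_norm_fourierMultiplierCLM_dilation_le f M hP K
  refine ⟨e, he₀, fun t ht i hi x => (he _ (hm.hasTemperateGrowth i) (ρ i) (hm.pos i) (hK i)
    (hm.eq_zero i hi) t ht x).trans ?_⟩
  have := hm.pos i
  gcongr (ρ i)⁻¹ ^ P * ?_
  exact le_add_of_nonneg_left (norm_nonneg _)

lemma IsSymbolFamily.exists_norm_low_le (hm : IsSymbolFamily i₀ m ρ) (f : 𝓢(Rn n, ℂ)) (M : ℕ) :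
    ∃ e : ℝ, 0 ≤ e ∧ ∀ t : ℝ, 1 ≤ t → ∀ x,
      ‖SchwartzMap.fourierMultiplierCLM ℂ (m i₀) (dilation t⁻¹ f) x‖ ≤
        envelope f M (e * t⁻¹) (t⁻¹ • x) := by
  obtain ⟨K, hK⟩ := hm.exists_bound
  have hm_growth := hm.hasTemperateGrowth i₀
  have hsub_growth : (fun ξ => 1 - m i₀ ξ).HasTemperateGrowth :=
    Function.HasTemperateGrowth.sub (.const 1) hm_growth
  obtain ⟨C, hC₀, hC⟩ :=
    exists_norm_fourierMultiplierCLM_dilation_le f M one_ne_zero fun j => ‖(1 : ℂ)‖ + K j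
  refine ⟨(ρ i₀)⁻¹ * C, mul_nonneg (inv_nonneg.mpr (hm.pos i₀).le) hC₀, fun t ht x => ?_⟩
  have hhigh := hC _ hsub_growth (ρ i₀) (hm.pos i₀)
    (norm_iteratedFDeriv_const_sub_le (hm.contDiff i₀) (hK i₀) 1)
    (fun ξ hξ => by rw [hm.eq_one ξ hξ, sub_self]) t ht x
  have hsplit := congr($(fourierMultiplierCLM_add_fourierMultiplierCLM_one_sub hm_growth
    (dilation t⁻¹ f)) x)
  rw [add_apply, dilation_apply (by positivity)] at hsplit
  calc ‖SchwartzMap.fourierMultiplierCLM ℂ (m i₀) (dilation t⁻¹ f) x‖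
      ≤ ‖f (t⁻¹ • x)‖ +
        ‖SchwartzMap.fourierMultiplierCLM ℂ (fun ξ => 1 - m i₀ ξ) (dilation t⁻¹ f) x‖ := by
        rw [← hsplit]
        exact norm_le_add_norm_add _ _
    _ ≤ envelope f M ((ρ i₀)⁻¹ * C * t⁻¹) (t⁻¹ • x) := by
        unfold envelope
        gcongr
        exact hhigh.trans_eq (by ring)

lemma IsSymbolFamily.exists_norm_fourierMultiplierCLM_dilation_le (hm : IsSymbolFamily i₀ m ρ)
    (f : 𝓢(Rn n, ℂ)) (M : ℕ) {P : ℕ} (hP : P ≠ 0) :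
    ∃ e : ℝ, 0 ≤ e ∧ ∀ t : ℝ, 1 ≤ t → ∀ i x,
      ‖SchwartzMap.fourierMultiplierCLM ℂ (m i) (dilation t⁻¹ f) x‖ ≤
        (ρ i)⁻¹ ^ P * envelope f M (e * t⁻¹) (t⁻¹ • x) := by
  obtain ⟨e₁, he₁, hhigh⟩ := hm.exists_norm_high_le f M hP
  obtain ⟨e₂, -, hlow⟩ := hm.exists_norm_low_le f M
  refine ⟨max e₁ e₂, le_max_of_le_left he₁, fun t ht i x => ?_⟩
  have hρ := hm.pos i
  have ht_inv : 0 ≤ t⁻¹ := by positivity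
  have hmono {e : ℝ} (he : e ≤ max e₁ e₂) :
      envelope f M (e * t⁻¹) (t⁻¹ • x) ≤ envelope f M (max e₁ e₂ * t⁻¹) (t⁻¹ • x) :=
    envelope_mono f M _ (mul_le_mul_of_nonneg_right he ht_inv)
  rcases eq_or_ne i i₀ with rfl | hi
  · refine ((hlow t ht x).trans (hmono (le_max_right _ _))).trans (le_mul_of_one_le_left ?_ ?_)
    · exact envelope_nonneg f M (mul_nonneg (le_max_of_le_left he₁) ht_inv) _
    · exact one_le_pow₀ ((one_le_inv₀ hρ).mpr hm.le_one)
  · refine (hhigh t ht i hi x).trans ?_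
    gcongr (ρ i)⁻¹ ^ P * ?_
    exact hmono (le_max_left _ _)

variable {p : ℝ≥0∞} {M : ℕ}

lemma eLpNorm_envelope_le (f : 𝓢(Rn n, ℂ)) {ε : ℝ} :
    eLpNorm (envelope f M ε) p ≤
      p.LpAddConst * (eLpNorm f p + ‖ε‖ₑ * eLpNorm (fun y : Rn n => (1 + ‖y‖) ^ (-M : ℝ)) p) := by
  have hdecay : Continuous fun y : Rn n => (1 + ‖y‖) ^ (-M : ℝ) :=
    (continuous_const.add continuous_norm).rpow_const fun y =>
      .inl (by positivity : 0 < 1 + ‖y‖).ne'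
  refine (eLpNorm_add_le' f.continuous.norm.aestronglyMeasurable
    (hdecay.const_smul ε).aestronglyMeasurable p).trans_eq ?_
  rw [eLpNorm_norm, eLpNorm_const_smul]

lemma limsup_dilationFactor_mul_le {N : 𝓢'(Rn n, ℂ) → ℝ≥0∞} {f : 𝓢(Rn n, ℂ)} {D : ℝ≥0∞} {e : ℝ}
    (hM : eLpNorm (fun y : Rn n => (1 + ‖y‖) ^ (-M : ℝ)) p ≠ ⊤) (hD : D ≠ ⊤)
    (hN : ∀ t : ℝ, 1 ≤ t →
      N (dilation t⁻¹ f : 𝓢(Rn n, ℂ)) ≤ D * eLpNorm (fun x => envelope f M (e * t⁻¹) (t⁻¹ • x)) p) :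
    limsup (fun t : ℝ => dilationFactor n p t * N (dilation t⁻¹ f : 𝓢(Rn n, ℂ))) atTop ≤
      D * p.LpAddConst * eLpNorm f p := by
  set W := eLpNorm (fun y : Rn n => (1 + ‖y‖) ^ (-M : ℝ)) p
  have hbound : ∀ᶠ t : ℝ in atTop, dilationFactor n p t * N (dilation t⁻¹ f : 𝓢(Rn n, ℂ)) ≤
      D * p.LpAddConst * (eLpNorm f p + ‖e * t⁻¹‖ₑ * W) := by
    filter_upwards [eventually_ge_atTop 1] with t ht
    calc dilationFactor n p t * N (dilation t⁻¹ f : 𝓢(Rn n, ℂ))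
        ≤ dilationFactor n p t *
          (D * eLpNorm (fun x => envelope f M (e * t⁻¹) (t⁻¹ • x)) p) := by gcongr; exact hN t ht
      _ = D * eLpNorm (envelope f M (e * t⁻¹)) p := by
          rw [mul_left_comm, dilationFactor_mul_eLpNorm_comp_inv_smul (by positivity)]
      _ ≤ _ := by
          rw [mul_assoc D]
          gcongr
          exact eLpNorm_envelope_le f
  have herror : Tendsto (fun t : ℝ => ‖e * t⁻¹‖ₑ * W) atTop (𝓝 0) := by
    have : Tendsto (fun t : ℝ => ‖e * t⁻¹‖ₑ) atTop (𝓝 0) := by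
      simpa using ((tendsto_inv_atTop_zero (𝕜 := ℝ)).const_mul e).enorm
    simpa using ENNReal.Tendsto.mul_const this (.inr hM)
  have hsum : Tendsto (fun t : ℝ => eLpNorm f p + ‖e * t⁻¹‖ₑ * W) atTop (𝓝 (eLpNorm f p)) := by
    simpa only [add_zero] using tendsto_const_nhds.add herror
  have hlimit := ENNReal.Tendsto.const_mul hsum
    (.inr (ENNReal.mul_ne_top hD (ENNReal.LpAddConst_lt_top p).ne))
  exact (limsup_le_limsup hbound).trans_eq hlimit.limsup_eq

end SymbolFamilies

section LqNorm

variable {ι : Type} {q : ℝ≥0∞}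

lemma lqNorm_mono (q : ℝ≥0∞) {a b : ι → ℝ≥0∞} (h : ∀ i, a i ≤ b i) : lqNorm q a ≤ lqNorm q b := by
  unfold lqNorm
  split_ifs
  · exact iSup_mono h
  · gcongr with i
    exact h i

lemma lqNorm_mul_const (hq : 0 < q) (a : ι → ℝ≥0∞) (c : ℝ≥0∞) :
    lqNorm q (fun i => a i * c) = lqNorm q a * c := by
  unfold lqNorm
  split_ifs with hq_top
  · rw [ENNReal.iSup_mul]
  · have hq₀ : 0 < q.toReal := ENNReal.toReal_pos hq.ne' hq_top
    simp_rw [ENNReal.mul_rpow_of_nonneg _ _ hq₀.le]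
    rw [ENNReal.tsum_mul_right, ENNReal.mul_rpow_of_nonneg _ _ (by positivity), one_div,
      ENNReal.rpow_rpow_inv hq₀.ne']

lemma le_lqNorm (hq : 0 < q) (a : ι → ℝ≥0∞) (i : ι) : a i ≤ lqNorm q a := by
  unfold lqNorm
  split_ifs with hq_top
  · exact le_iSup a i
  · have hq₀ : 0 < q.toReal := ENNReal.toReal_pos hq.ne' hq_top
    rw [one_div, ENNReal.le_rpow_inv_iff hq₀]
    exact ENNReal.le_tsum i

lemma lqNorm_zero (hq : 0 < q) : lqNorm q (fun _ : ι => 0) = 0 := by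
  simpa using lqNorm_mul_const hq (fun _ : ι => 0) 0

end LqNorm

section AdmissibleNorms

variable {n : ℕ}

lemma represents_zero_of_ae_eq_zero {g : Rn n → ℂ} (hg : ∀ᵐ x, g x = 0) : Represents g 0 := by
  have hg_symm : (0 : Rn n → ℂ) =ᵐ[volume] g := hg.mono fun _ hx => hx.symm
  refine ⟨((integrable_zero _ _ _).congr hg_symm).locallyIntegrable, fun f _ => ?_⟩
  rw [integral_eq_zero_of_ae (hg.mono fun x hx => by simp [hx])]
  simp

lemma represents_zero : Represents (fun _ : Rn n => 0) 0 :=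
  represents_zero_of_ae_eq_zero (.of_forall fun _ => rfl)

lemma represents_toTemperedDistribution (f : 𝓢(Rn n, ℂ)) : Represents f (f : 𝓢'(Rn n, ℂ)) :=
  ⟨f.continuous.locallyIntegrable, fun g _ => SchwartzMap.coe_apply f g⟩

lemma distLpNorm_le {f : Rn n → ℂ} {u : 𝓢'(Rn n, ℂ)} (h : Represents f u) (p : ℝ≥0∞) :
    distLpNorm p u ≤ eLpNorm f p :=
  iInf₂_le f h

lemma distLpNorm_zero (p : ℝ≥0∞) : distLpNorm p (0 : 𝓢'(Rn n, ℂ)) = 0 := by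
  simpa using distLpNorm_le represents_zero p

/-- The properties shared by the quasi-norms of Triebel-Lizorkin, Besov and modulation spaces: they
dominate the `L^p` norm of the low frequencies and, after the renormalization that makes dilations
isometric on `L^p`, the quasi-norm of `f (t⁻¹ •)` is at most comparable to the `L^p` norm of `f` as
`t → ∞`. -/
structure IsAdmissibleNorm (p : ℝ≥0∞) (N : 𝓢'(Rn n, ℂ) → ℝ≥0∞) : Prop where
  map_zero : N 0 = 0
  exists_distLpNorm_le : ∃ m : 𝓢(Rn n, ℂ), m 0 = 1 ∧
    ∀ v, distLpNorm p (TemperedDistribution.fourierMultiplierCLM ℂ m v) ≤ N v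
  exists_limsup_le : ∃ D : ℝ≥0∞, D ≠ ⊤ ∧ ∀ f : 𝓢(Rn n, ℂ),
    limsup (fun t : ℝ => dilationFactor n p t * N (dilation t⁻¹ f : 𝓢(Rn n, ℂ))) atTop ≤
      D * eLpNorm f p

variable {ι : Type} {i₀ : ι} {m : ι → Rn n → ℂ} {ρ : ι → ℝ} {w : ι → ℝ≥0∞} {p q : ℝ≥0∞}

/-- The `ℓ^q (L^p)` norm of the weighted frequency pieces `w i • m i (D) u`, the common form of the
Besov and modulation norms. -/
def lqLpNorm (q p : ℝ≥0∞) (w : ι → ℝ≥0∞) (m : ι → Rn n → ℂ) (u : 𝓢'(Rn n, ℂ)) : ℝ≥0∞ :=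
  lqNorm q fun i => w i * distLpNorm p (TemperedDistribution.fourierMultiplierCLM ℂ (m i) u)

/-- The `L^p (ℓ^q)` norm of the weighted frequency pieces `w i • m i (D) u`, the form of the
Triebel-Lizorkin norm. As there, the infimum only reads the pieces as functions. -/
def lpLqNorm (p q : ℝ≥0∞) (w : ι → ℝ≥0∞) (m : ι → Rn n → ℂ) (u : 𝓢'(Rn n, ℂ)) : ℝ≥0∞ :=
  ⨅ (g : ι → Rn n → ℂ)
    (_ : ∀ i, Represents (g i) (TemperedDistribution.fourierMultiplierCLM ℂ (m i) u)),
    eLpNorm (fun x => lqNorm q fun i => w i * ‖g i x‖ₑ) p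

lemma lpLqNorm_le {g : ι → Rn n → ℂ} {u : 𝓢'(Rn n, ℂ)}
    (hg : ∀ i, Represents (g i) (TemperedDistribution.fourierMultiplierCLM ℂ (m i) u)) :
    lpLqNorm p q w m u ≤ eLpNorm (fun x => lqNorm q fun i => w i * ‖g i x‖ₑ) p :=
  iInf₂_le g hg

lemma lqLpNorm_zero (hq : 0 < q) : lqLpNorm q p w m (0 : 𝓢'(Rn n, ℂ)) = 0 := by
  simpa only [lqLpNorm, map_zero, distLpNorm_zero, mul_zero] using lqNorm_zero hq

lemma lpLqNorm_zero (hq : 0 < q) : lpLqNorm p q w m (0 : 𝓢'(Rn n, ℂ)) = 0 := by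
  have hg (i : ι) : Represents (fun _ => 0)
      (TemperedDistribution.fourierMultiplierCLM ℂ (m i) (0 : 𝓢'(Rn n, ℂ))) := by
    rw [map_zero]
    exact represents_zero
  refine le_antisymm ((lpLqNorm_le hg).trans_eq ?_) zero_le
  simp only [enorm_zero, mul_zero, lqNorm_zero hq, eLpNorm_zero']

lemma distLpNorm_le_lqLpNorm (hq : 0 < q) (hw : w i₀ = 1) (u : 𝓢'(Rn n, ℂ)) :
    distLpNorm p (TemperedDistribution.fourierMultiplierCLM ℂ (m i₀) u) ≤ lqLpNorm q p w m u := by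
  simpa only [lqLpNorm, hw, one_mul] using le_lqNorm hq
    (fun i => w i * distLpNorm p (TemperedDistribution.fourierMultiplierCLM ℂ (m i) u)) i₀

lemma distLpNorm_le_lpLqNorm (hq : 0 < q) (hw : w i₀ = 1) (u : 𝓢'(Rn n, ℂ)) :
    distLpNorm p (TemperedDistribution.fourierMultiplierCLM ℂ (m i₀) u) ≤ lpLqNorm p q w m u := by
  refine le_iInf₂ fun g hg => (distLpNorm_le (hg i₀) p).trans (eLpNorm_mono_enorm fun x => ?_)
  simpa only [hw, one_mul, enorm_eq_self] using le_lqNorm hq (fun i => w i * ‖g i x‖ₑ) i₀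

lemma enorm_le_ofReal_mul_enorm {E : Type*} [NormedAddCommGroup E] {a : E} {b c : ℝ} (hb : 0 ≤ b)
    (h : ‖a‖ ≤ b * c) : ‖a‖ₑ ≤ ENNReal.ofReal b * ‖c‖ₑ := by
  rw [← ofReal_norm, ← ofReal_norm, ← ENNReal.ofReal_mul hb]
  exact ENNReal.ofReal_le_ofReal (h.trans (by gcongr; exact Real.le_norm_self c))

lemma lqLpNorm_toTemperedDistribution_le (hm : ∀ i, (m i).HasTemperateGrowth) (hq : 0 < q)
    {f : 𝓢(Rn n, ℂ)} {b : ι → ℝ} (hb : ∀ i, 0 ≤ b i) {G : Rn n → ℝ}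
    (hG : ∀ i x, ‖SchwartzMap.fourierMultiplierCLM ℂ (m i) f x‖ ≤ b i * G x) :
    lqLpNorm q p w m (f : 𝓢'(Rn n, ℂ)) ≤
      lqNorm q (fun i => w i * ENNReal.ofReal (b i)) * eLpNorm G p := by
  rw [← lqNorm_mul_const hq]
  refine lqNorm_mono q fun i => ?_
  rw [TemperedDistribution.fourierMultiplierCLM_toTemperedDistributionCLM_eq (hm i), mul_assoc]
  gcongr
  refine (distLpNorm_le (represents_toTemperedDistribution _) p).trans ?_
  exact eLpNorm_le_mul_eLpNorm_of_ae_le_mul' (c := (b i).toNNReal)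
    (.of_forall fun x => enorm_le_ofReal_mul_enorm (hb i) (hG i x)) p

lemma lpLqNorm_toTemperedDistribution_le (hm : ∀ i, (m i).HasTemperateGrowth) (hq : 0 < q)
    {f : 𝓢(Rn n, ℂ)} {b : ι → ℝ} (hb : ∀ i, 0 ≤ b i) {G : Rn n → ℝ}
    (hG : ∀ i x, ‖SchwartzMap.fourierMultiplierCLM ℂ (m i) f x‖ ≤ b i * G x)
    (hfin : lqNorm q (fun i => w i * ENNReal.ofReal (b i)) ≠ ⊤) :
    lpLqNorm p q w m (f : 𝓢'(Rn n, ℂ)) ≤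
      lqNorm q (fun i => w i * ENNReal.ofReal (b i)) * eLpNorm G p := by
  have hrep (i : ι) : Represents (SchwartzMap.fourierMultiplierCLM ℂ (m i) f)
      (TemperedDistribution.fourierMultiplierCLM ℂ (m i) (f : 𝓢'(Rn n, ℂ))) := by
    rw [TemperedDistribution.fourierMultiplierCLM_toTemperedDistributionCLM_eq (hm i)]
    exact represents_toTemperedDistribution _
  refine (lpLqNorm_le hrep).trans ?_
  rw [← ENNReal.coe_toNNReal hfin]
  refine eLpNorm_le_mul_eLpNorm_of_ae_le_mul' (.of_forall fun x => ?_) p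
  rw [ENNReal.coe_toNNReal hfin, ← lqNorm_mul_const hq, enorm_eq_self]
  refine lqNorm_mono q fun i => ?_
  rw [mul_assoc]
  gcongr
  exact enorm_le_ofReal_mul_enorm (hb i) (hG i x)

lemma IsSymbolFamily.isAdmissibleNorm (hm : IsSymbolFamily i₀ m ρ) {N : 𝓢'(Rn n, ℂ) → ℝ≥0∞}
    {P : ℕ} (hP : P ≠ 0) {D : ℝ≥0∞} (hD : D ≠ ⊤) (map_zero : N 0 = 0)
    (hlow : ∀ u, distLpNorm p (TemperedDistribution.fourierMultiplierCLM ℂ (m i₀) u) ≤ N u)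
    (hpieces : ∀ (f : 𝓢(Rn n, ℂ)) (G : Rn n → ℝ),
      (∀ i x, ‖SchwartzMap.fourierMultiplierCLM ℂ (m i) f x‖ ≤ (ρ i)⁻¹ ^ P * G x) →
        N f ≤ D * eLpNorm G p) :
    IsAdmissibleNorm p N where
  map_zero := map_zero
  exists_distLpNorm_le := by
    refine ⟨(hm.hasCompactSupport i₀).toSchwartzMap (hm.contDiff i₀),
      hm.eq_one 0 (by simpa using hm.pos i₀), hlow⟩
  exists_limsup_le := by
    obtain ⟨M, hM⟩ := Measure.HasTemperateGrowth.exists_eLpNorm_lt_top (E := Rn n) p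
      (μ := volume) inferInstance
    refine ⟨D * p.LpAddConst, ENNReal.mul_ne_top hD (ENNReal.LpAddConst_lt_top p).ne, fun f => ?_⟩
    obtain ⟨e, -, he⟩ := hm.exists_norm_fourierMultiplierCLM_dilation_le f M hP
    have hN (t : ℝ) (ht : 1 ≤ t) : N (dilation t⁻¹ f : 𝓢(Rn n, ℂ)) ≤
        D * eLpNorm (fun x => envelope f M (e * t⁻¹) (t⁻¹ • x)) p := hpieces _ _ (he t ht)
    exact limsup_dilationFactor_mul_le hM.ne hD hN

lemma IsSymbolFamily.isAdmissibleNorm_lqLpNorm (hm : IsSymbolFamily i₀ m ρ) (hq : 0 < q)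
    (hw : w i₀ = 1) {P : ℕ} (hP : P ≠ 0)
    (hfin : lqNorm q (fun i => w i * ENNReal.ofReal ((ρ i)⁻¹ ^ P)) ≠ ⊤) :
    IsAdmissibleNorm p (lqLpNorm q p w m) :=
  hm.isAdmissibleNorm hP hfin (lqLpNorm_zero hq) (distLpNorm_le_lqLpNorm hq hw) fun _ _ =>
    lqLpNorm_toTemperedDistribution_le hm.hasTemperateGrowth hq
      fun i => pow_nonneg (inv_nonneg.mpr (hm.pos i).le) P

lemma IsSymbolFamily.isAdmissibleNorm_lpLqNorm (hm : IsSymbolFamily i₀ m ρ) (hq : 0 < q)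
    (hw : w i₀ = 1) {P : ℕ} (hP : P ≠ 0)
    (hfin : lqNorm q (fun i => w i * ENNReal.ofReal ((ρ i)⁻¹ ^ P)) ≠ ⊤) :
    IsAdmissibleNorm p (lpLqNorm p q w m) :=
  hm.isAdmissibleNorm hP hfin (lpLqNorm_zero hq) (distLpNorm_le_lpLqNorm hq hw) fun _ _ hG =>
    lpLqNorm_toTemperedDistribution_le hm.hasTemperateGrowth hq
      (fun i => pow_nonneg (inv_nonneg.mpr (hm.pos i).le) P) hG hfin

end AdmissibleNorms

section Transfer

variable {n : ℕ} {p : ℝ≥0∞} {N : 𝓢'(Rn n, ℂ) → ℝ≥0∞} {Φ f : Rn n → ℂ} {𝒟 : Set (Rn n → ℂ)}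

lemma hausdorff_comp_smul (Φ f : Rn n → ℂ) (c : ℝ) (x : Rn n) :
    hausdorff Φ (fun y => f (c • y)) x = hausdorff Φ f (c • x) := by
  simp only [hausdorff, smul_comm c]

lemma testAwayFromZero_comp_smul (hf : f ∈ testAwayFromZero n) {c : ℝ} (hc : c ≠ 0) :
    (fun x => f (c • x)) ∈ testAwayFromZero n := by
  refine ⟨hf.1.comp (contDiff_const_smul c), hf.2.1.comp_smul hc, fun h => hf.2.2 ?_⟩
  simpa using tsupport_comp_subset_preimage f (f := fun x : Rn n => c • x) (by fun_prop) h

lemma locallyIntegrable_of_comp_smul {g : Rn n → ℂ} {c : ℝ} (hc : c ≠ 0)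
    (hg : LocallyIntegrable fun x => g (c • x)) : LocallyIntegrable g := by
  have hmap : Measure.map (Homeomorph.smulOfNeZero c hc) volume =
      ENNReal.ofReal |(c ^ Module.finrank ℝ (Rn n))⁻¹| • (volume : Measure (Rn n)) :=
    Measure.map_addHaar_smul volume hc
  intro x
  obtain ⟨U, hU, hgU⟩ :=
    (locallyIntegrable_map_homeomorph (Homeomorph.smulOfNeZero c hc)).mpr hg x
  refine ⟨U, hU, ?_⟩
  rwa [hmap, IntegrableOn, Measure.restrict_smul,
    integrable_smul_measure (by positivity) ENNReal.ofReal_ne_top] at hgU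

lemma Represents.exists_of_comp_inv_smul {g : Rn n → ℂ} {w : 𝓢'(Rn n, ℂ)} {t : ℝ} (ht : 0 < t)
    (hw : Represents (fun x => g (t⁻¹ • x)) w) : ∃ v, Represents g v := by
  have ht' : t⁻¹ ≠ 0 := inv_ne_zero ht.ne'
  let v : 𝓢'(Rn n, ℂ) := PointwiseConvergenceCLM.precomp ℂ (normalizedDilation t⁻¹) w
  have hv (h : 𝓢(Rn n, ℂ)) : v h = w (normalizedDilation t⁻¹ h) := rfl
  refine ⟨v, locallyIntegrable_of_comp_smul ht' hw.1, fun h hh => ?_⟩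
  rw [hv, hw.2 _ (hasCompactSupport_normalizedDilation ht' hh),
    ← pow_smul_integral_comp_smul (inv_pos.mpr ht) (fun x => h x * g x), ← integral_smul]
  congr 1 with x
  rw [normalizedDilation_apply ht', smul_mul_assoc]

lemma IsAdmissibleNorm.eventually_lt_top (hN : IsAdmissibleNorm p N) (f : 𝓢(Rn n, ℂ)) :
    ∀ᶠ t : ℝ in atTop, N (dilation t⁻¹ f : 𝓢(Rn n, ℂ)) < ⊤ := by
  obtain ⟨D, hD, hle⟩ := hN.exists_limsup_le
  have hlt := (hle f).trans_lt (ENNReal.mul_lt_top hD.lt_top (f.eLpNorm_lt_top p volume))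
  filter_upwards [eventually_lt_of_limsup_lt hlt, eventually_gt_atTop 0] with t ht ht₀
  exact ENNReal.lt_top_of_mul_ne_top_right ht.ne (dilationFactor_ne_zero ht₀)

theorem IsAdmissibleNorm.exists_eLpNorm_hausdorff_le (hN : IsAdmissibleNorm p N)
    (h𝒟 : testAwayFromZero n ⊆ 𝒟) (hb : IsBoundedOn Φ 𝒟 N) :
    ∃ C : ℝ≥0∞, C ≠ ⊤ ∧ ∀ f ∈ testAwayFromZero n, (∀ᵐ x, ContinuousAt (hausdorff Φ f) x) →
      eLpNorm (hausdorff Φ f) p ≤ C * eLpNorm f p := by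
  obtain ⟨m, hm, hlow⟩ := hN.exists_distLpNorm_le
  obtain ⟨D, hD, hhigh⟩ := hN.exists_limsup_le
  obtain ⟨C, hC⟩ := hb
  refine ⟨C * D, ENNReal.mul_ne_top ENNReal.coe_ne_top hD, fun f hf hcont => ?_⟩
  obtain ⟨f, rfl⟩ : ∃ g : 𝓢(Rn n, ℂ), ⇑g = f := ⟨hf.2.1.toSchwartzMap hf.1, rfl⟩
  have hex : ∀ᶠ t : ℝ in atTop, ∃ w : 𝓢'(Rn n, ℂ),
      Represents (fun x => hausdorff Φ f (t⁻¹ • x)) w ∧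
      N w ≤ C * N (dilation t⁻¹ f : 𝓢(Rn n, ℂ)) := by
    filter_upwards [hN.eventually_lt_top f, eventually_gt_atTop 0] with t hfin ht
    have hrep := represents_toTemperedDistribution (dilation t⁻¹ f)
    rw [coe_dilation (inv_ne_zero ht.ne')] at hrep
    simpa only [funext (hausdorff_comp_smul Φ f t⁻¹)] using
      hC _ (h𝒟 (testAwayFromZero_comp_smul hf (inv_ne_zero ht.ne'))) _ hrep hfin
  obtain ⟨w, hw⟩ := hex.choice
  obtain ⟨t₀, hwt₀, ht₀⟩ := (hw.and (eventually_gt_atTop 0)).exists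
  obtain ⟨v, hv⟩ := hwt₀.1.exists_of_comp_inv_smul ht₀
  have hle : ∀ᶠ t : ℝ in atTop, dilationFactor n p t *
      distLpNorm p (TemperedDistribution.fourierMultiplierCLM ℂ m (w t)) ≤
      C * (dilationFactor n p t * N (dilation t⁻¹ f : 𝓢(Rn n, ℂ))) := by
    filter_upwards [hw] with t ht
    rw [mul_left_comm]
    gcongr
    exact (hlow _).trans ht.2
  have hlimsup := limsup_le_limsup hle
  rw [ENNReal.limsup_const_mul_of_ne_top ENNReal.coe_ne_top] at hlimsup
  have hliminf := hv.eLpNorm_le_liminf hcont hm (hw.mono fun t ht => ht.1) p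
  refine (hliminf.trans liminf_le_limsup).trans (hlimsup.trans ?_)
  rw [mul_assoc]
  gcongr
  exact hhigh f

end Transfer

/-! ### The dyadic and the uniform symbols -/

lemma lqNorm_ne_top_of_le {ι : Type} {q : ℝ≥0∞} (hq : 0 < q) {a : ι → ℝ≥0∞} {b : ι → ℝ} {B : ℝ}
    (hb₀ : ∀ i, 0 ≤ b i) (hb₁ : ∀ i, b i ≤ 1) (hsum : q ≠ ⊤ → Summable fun i => b i ^ q.toReal)
    (h : ∀ i, a i ≤ ENNReal.ofReal (b i * B)) : lqNorm q a ≠ ⊤ := by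
  have hle : lqNorm q a ≤ lqNorm q (fun i => ENNReal.ofReal (b i)) * ENNReal.ofReal B := by
    rw [← lqNorm_mul_const hq]
    exact lqNorm_mono q fun i => (h i).trans (ENNReal.ofReal_mul (hb₀ i)).le
  refine ne_top_of_le_ne_top (ENNReal.mul_ne_top ?_ ENNReal.ofReal_ne_top) hle
  unfold lqNorm
  split_ifs with hq_top
  · exact ne_top_of_le_ne_top ENNReal.one_ne_top
      (iSup_le fun i => ENNReal.ofReal_le_one.mpr (hb₁ i))
  · refine ENNReal.rpow_ne_top_of_nonneg (by positivity) ?_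
    simp_rw [ENNReal.ofReal_rpow_of_nonneg (hb₀ _) ENNReal.toReal_nonneg]
    exact (hsum hq_top).tsum_ofReal_ne_top

section Dyadic

variable {n : ℕ} {φ : Rn n → ℝ}

lemma dyadicSymbol_succ (φ : Rn n → ℝ) (j : ℕ) :
    dyadicSymbol φ (j + 1) =
      (fun ξ => φ (((2 : ℝ) ^ (j + 1))⁻¹ • ξ)) - fun ξ => φ (((2 : ℝ) ^ j)⁻¹ • ξ) := by
  ext ξ
  simp only [dyadicSymbol, Pi.sub_apply]
  rw [smul_smul, pow_succ, mul_inv_rev, mul_inv_cancel_left₀ two_ne_zero]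

lemma contDiff_ofReal_comp {f : Rn n → ℝ} (hf : ContDiff ℝ ∞ f) :
    ContDiff ℝ ∞ fun ξ => (f ξ : ℂ) :=
  Complex.ofRealCLM.contDiff.comp hf

lemma hasCompactSupport_ofReal_comp {f : Rn n → ℝ} (hf : HasCompactSupport f) :
    HasCompactSupport fun ξ => (f ξ : ℂ) :=
  hf.comp_left (g := fun r : ℝ => (r : ℂ)) Complex.ofReal_zero

lemma exists_norm_iteratedFDeriv_le {f : Rn n → ℂ} (hf : ContDiff ℝ ∞ f)
    (hf_supp : HasCompactSupport f) :
    ∃ K : ℕ → ℝ, ∀ j ξ, ‖iteratedFDeriv ℝ j f ξ‖ ≤ K j :=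
  ⟨fun j => SchwartzMap.seminorm ℂ 0 j (hf_supp.toSchwartzMap hf),
    (hf_supp.toSchwartzMap hf).norm_iteratedFDeriv_le_seminorm ℂ⟩

namespace IsDyadicBump

lemma hasCompactSupport (hφ : IsDyadicBump φ) : HasCompactSupport φ :=
  HasCompactSupport.of_support_subset_isCompact (isCompact_closedBall 0 (3 / 2))
    (hφ.support_subset.trans Metric.ball_subset_closedBall)

lemma contDiff_dyadicSymbol (hφ : IsDyadicBump φ) : ∀ j, ContDiff ℝ ∞ (dyadicSymbol φ j)
  | 0 => hφ.smooth
  | j + 1 => by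
    rw [dyadicSymbol_succ]
    exact (hφ.smooth.comp (contDiff_const_smul _)).sub (hφ.smooth.comp (contDiff_const_smul _))

lemma hasCompactSupport_dyadicSymbol (hφ : IsDyadicBump φ) :
    ∀ j, HasCompactSupport (dyadicSymbol φ j)
  | 0 => hφ.hasCompactSupport
  | j + 1 => by
    rw [dyadicSymbol_succ]
    exact (hφ.hasCompactSupport.comp_smul (by positivity)).sub
      (hφ.hasCompactSupport.comp_smul (by positivity))

lemma exists_norm_iteratedFDeriv_dyadicSymbol_le (hφ : IsDyadicBump φ) :
    ∃ K : ℕ → ℝ, ∀ i j ξ, ‖iteratedFDeriv ℝ j (fun ξ => (dyadicSymbol φ i ξ : ℂ)) ξ‖ ≤ K j := by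
  have hψ := contDiff_ofReal_comp hφ.smooth
  obtain ⟨K, hK⟩ := exists_norm_iteratedFDeriv_le hψ
    (hasCompactSupport_ofReal_comp hφ.hasCompactSupport)
  have hK_dilated (k j : ℕ) (ξ : Rn n) :
      ‖iteratedFDeriv ℝ j (fun ξ => (φ (((2 : ℝ) ^ k)⁻¹ • ξ) : ℂ)) ξ‖ ≤ K j := by
    refine norm_iteratedFDeriv_comp_smul_le hψ hK ?_ j ξ
    rw [abs_of_pos (by positivity)]
    exact inv_le_one_of_one_le₀ (one_le_pow₀ one_le_two)
  have hsmooth (k j : ℕ) (ξ : Rn n) :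
      ContDiffAt ℝ j (fun ξ => (φ (((2 : ℝ) ^ k)⁻¹ • ξ) : ℂ)) ξ :=
    ((hψ.comp (contDiff_const_smul _)).of_le (by exact_mod_cast le_top)).contDiffAt
  refine ⟨fun j => K j + K j, fun i j ξ => ?_⟩
  cases i with
  | zero => exact (hK j ξ).trans (le_add_of_nonneg_left ((norm_nonneg _).trans (hK j ξ)))
  | succ i =>
    simp_rw [dyadicSymbol_succ, Pi.sub_apply, Complex.ofReal_sub]
    rw [fun_iteratedFDeriv_sub_apply (hsmooth _ j ξ) (hsmooth _ j ξ)]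
    exact norm_sub_le_of_le (hK_dilated _ j ξ) (hK_dilated _ j ξ)

lemma apply_inv_pow_smul (hφ : IsDyadicBump φ) {i k : ℕ} (hik : i ≤ k) {ξ : Rn n}
    (hξ : ‖ξ‖ < 2 ^ i) : φ (((2 : ℝ) ^ k)⁻¹ • ξ) = 1 := by
  have hpow : (2 : ℝ) ^ i ≤ 2 ^ k := pow_le_pow_right₀ one_le_two hik
  refine hφ.eq_one _ ?_
  rw [norm_smul, norm_inv, Real.norm_of_nonneg (by positivity), inv_mul_le_iff₀ (by positivity)]
  linarith [norm_nonneg ξ]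

theorem isSymbolFamily (hφ : IsDyadicBump φ) :
    IsSymbolFamily 0 (fun j ξ => (dyadicSymbol φ j ξ : ℂ)) (fun j : ℕ => (2 : ℝ) ^ j / 2) where
  contDiff j := contDiff_ofReal_comp (hφ.contDiff_dyadicSymbol j)
  hasCompactSupport j := hasCompactSupport_ofReal_comp (hφ.hasCompactSupport_dyadicSymbol j)
  exists_bound := hφ.exists_norm_iteratedFDeriv_dyadicSymbol_le
  pos j := by positivity
  le_one := by norm_num
  eq_zero j hj ξ hξ := by
    obtain ⟨i, rfl⟩ := Nat.exists_eq_succ_of_ne_zero hj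
    rw [Nat.succ_eq_add_one, pow_succ, mul_div_cancel_right₀ _ two_ne_zero] at hξ
    rw [dyadicSymbol_succ, Pi.sub_apply, hφ.apply_inv_pow_smul i.le_succ hξ,
      hφ.apply_inv_pow_smul le_rfl hξ, sub_self, Complex.ofReal_zero]
  eq_one ξ hξ := by
    rw [dyadicSymbol, hφ.eq_one ξ (by norm_num at hξ; linarith), Complex.ofReal_one]

end IsDyadicBump

lemma summable_half_pow_rpow {r : ℝ} (hr : 0 < r) :
    Summable fun j : ℕ => ((1 / 2 : ℝ) ^ j) ^ r := by
  simp_rw [← Real.rpow_pow_comm (one_half_pos (α := ℝ)).le]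
  exact summable_geometric_of_lt_one (by positivity)
    (Real.rpow_lt_one (by norm_num) one_half_lt_one hr)

lemma two_rpow_mul_inv_pow_le (s : ℝ) (j : ℕ) :
    (2 : ℝ) ^ ((j : ℝ) * s) * ((2 : ℝ) ^ j / 2)⁻¹ ^ (⌈|s|⌉₊ + 1) ≤
      (1 / 2) ^ j * 2 ^ (⌈|s|⌉₊ + 1) := by
  have hpow : (2 : ℝ) ^ ((j : ℝ) * s) ≤ (2 ^ j) ^ ⌈|s|⌉₊ := by
    rw [← pow_mul, ← Real.rpow_natCast, Nat.cast_mul]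
    gcongr
    · exact one_le_two
    · exact (le_abs_self s).trans (Nat.le_ceil _)
  calc (2 : ℝ) ^ ((j : ℝ) * s) * ((2 : ℝ) ^ j / 2)⁻¹ ^ (⌈|s|⌉₊ + 1)
      ≤ (2 ^ j) ^ ⌈|s|⌉₊ * ((2 : ℝ) ^ j / 2)⁻¹ ^ (⌈|s|⌉₊ + 1) := by gcongr
    _ = (1 / 2) ^ j * 2 ^ (⌈|s|⌉₊ + 1) := by
        rw [inv_div, div_pow, pow_succ ((2 : ℝ) ^ j), one_div, inv_pow]
        field_simp

lemma lqNorm_dyadic_ne_top {q : ℝ≥0∞} (hq : 0 < q) (s : ℝ) :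
    lqNorm q (fun j : ℕ => (2 : ℝ≥0∞) ^ ((j : ℝ) * s) *
      ENNReal.ofReal (((2 : ℝ) ^ j / 2)⁻¹ ^ (⌈|s|⌉₊ + 1))) ≠ ⊤ := by
  refine lqNorm_ne_top_of_le hq (b := fun j : ℕ => (1 / 2 : ℝ) ^ j) (B := 2 ^ (⌈|s|⌉₊ + 1))
    (fun j => by positivity) (fun j => pow_le_one₀ (by norm_num) (by norm_num))
    (fun hq_top => summable_half_pow_rpow (ENNReal.toReal_pos hq.ne' hq_top)) fun j => ?_
  rw [← ENNReal.ofReal_ofNat, ENNReal.ofReal_rpow_of_pos two_pos,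
    ← ENNReal.ofReal_mul (by positivity)]
  exact ENNReal.ofReal_le_ofReal (two_rpow_mul_inv_pow_le s j)

theorem IsDyadicBump.isAdmissibleNorm_besovNorm (hφ : IsDyadicBump φ) (p : ℝ≥0∞) {q : ℝ≥0∞}
    (hq : 0 < q) (s : ℝ) : IsAdmissibleNorm p (besovNorm φ p q s) :=
  hφ.isSymbolFamily.isAdmissibleNorm_lqLpNorm (w := fun j : ℕ => (2 : ℝ≥0∞) ^ ((j : ℝ) * s)) hq
    (by simp) (Nat.succ_ne_zero _) (lqNorm_dyadic_ne_top hq s)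

theorem IsDyadicBump.isAdmissibleNorm_triebelLizorkinNorm (hφ : IsDyadicBump φ) (p : ℝ≥0∞)
    {q : ℝ≥0∞} (hq : 0 < q) (s : ℝ) : IsAdmissibleNorm p (triebelLizorkinNorm φ p q s) :=
  hφ.isSymbolFamily.isAdmissibleNorm_lpLqNorm (w := fun j : ℕ => (2 : ℝ≥0∞) ^ ((j : ℝ) * s)) hq
    (by simp) (Nat.succ_ne_zero _) (lqNorm_dyadic_ne_top hq s)

end Dyadic

section Uniform

variable {n : ℕ} {η : Rn n → ℝ}

lemma latticePt_apply (k : Fin n → ℤ) (i : Fin n) : latticePt k i = k i := rfl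

lemma latticePt_add (k l : Fin n → ℤ) : latticePt (k + l) = latticePt k + latticePt l := by
  ext i
  simp [latticePt_apply]

lemma latticePt_zero : latticePt (0 : Fin n → ℤ) = 0 := by
  ext i
  simp [latticePt_apply]

lemma latticePt_injective : Function.Injective (latticePt : (Fin n → ℤ) → Rn n) := fun _ _ h =>
  funext fun i => Int.cast_injective (α := ℝ) (congrArg (fun x : Rn n => x i) h)

lemma norm_le_of_forall_abs_le {x : Rn n} {c : ℝ} (h : ∀ i, |x i| ≤ c) : ‖x‖ ≤ n * c := by
  calc ‖x‖ = ‖∑ i, x i • EuclideanSpace.basisFun (Fin n) ℝ i‖ := by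
        conv_lhs => rw [← (EuclideanSpace.basisFun (Fin n) ℝ).sum_repr x]
        simp only [EuclideanSpace.basisFun_repr]
    _ ≤ ∑ _i : Fin n, c := norm_sum_le_of_le _ fun i _ => by
        rw [norm_smul, OrthonormalBasis.norm_eq_one, mul_one]
        exact h i
    _ = n * c := by simp

lemma abs_apply_le_norm (x : Rn n) (i : Fin n) : |x i| ≤ ‖x‖ := PiLp.norm_apply_le x i

/-- The sum of all integer translates of `η`, the denominator of the uniform symbols. -/
def translateSum (η : Rn n → ℝ) (ξ : Rn n) : ℝ := ∑' l : Fin n → ℤ, η (ξ - latticePt l)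

lemma uniformSymbol_eq_div (η : Rn n → ℝ) (k : Fin n → ℤ) (ξ : Rn n) :
    uniformSymbol η k ξ = η (ξ - latticePt k) / translateSum η ξ := rfl

lemma translateSum_sub_latticePt (η : Rn n → ℝ) (ξ : Rn n) (k : Fin n → ℤ) :
    translateSum η (ξ - latticePt k) = translateSum η ξ := by
  unfold translateSum
  rw [← (Equiv.addLeft k).tsum_eq (fun l => η (ξ - latticePt l))]
  simp only [Equiv.coe_addLeft, latticePt_add, sub_sub]

lemma uniformSymbol_eq_comp_sub (η : Rn n → ℝ) (k : Fin n → ℤ) (ξ : Rn n) :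
    uniformSymbol η k ξ = uniformSymbol η 0 (ξ - latticePt k) := by
  rw [uniformSymbol_eq_div, uniformSymbol_eq_div, latticePt_zero, sub_zero,
    translateSum_sub_latticePt]

/-- A finite set that contains all lattice points `l` at which `η (ξ - l) ≠ 0` for some `ξ` in the
unit ball around `ξ₀`. -/
def nearLattice (ξ₀ : Rn n) : Finset (Fin n → ℤ) :=
  Fintype.piFinset fun i => Finset.Icc ⌊ξ₀ i - 2⌋ ⌈ξ₀ i + 2⌉

namespace IsUniformBump

lemma abs_lt_of_ne_zero (hη : IsUniformBump η) {ξ : Rn n} (h : η ξ ≠ 0) (i : Fin n) :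
    |ξ i| < 3 / 4 := by
  contrapose! h
  exact hη.eq_zero ξ ⟨i, h⟩

lemma eq_zero_of_notMem_nearLattice (hη : IsUniformBump η) {ξ₀ ξ : Rn n} (hξ : ‖ξ - ξ₀‖ < 1)
    {l : Fin n → ℤ} (hl : l ∉ nearLattice ξ₀) : η (ξ - latticePt l) = 0 := by
  by_contra h
  refine hl (Fintype.mem_piFinset.mpr fun i => Finset.mem_Icc.mpr ?_)
  have hξl := abs_lt.mp (hη.abs_lt_of_ne_zero h i)
  have hξξ₀ := abs_lt.mp ((abs_apply_le_norm (ξ - ξ₀) i).trans_lt hξ)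
  rw [PiLp.sub_apply, latticePt_apply] at hξl
  rw [PiLp.sub_apply] at hξξ₀
  constructor
  · rw [← Int.cast_le (R := ℝ)]
    linarith [Int.floor_le (ξ₀ i - 2)]
  · rw [← Int.cast_le (R := ℝ)]
    linarith [Int.le_ceil (ξ₀ i + 2)]

lemma contDiff_translateSum (hη : IsUniformBump η) : ContDiff ℝ ∞ (translateSum η) := by
  rw [contDiff_iff_contDiffAt]
  intro ξ₀
  have hsum : ContDiff ℝ ∞ fun ξ => ∑ l ∈ nearLattice ξ₀, η (ξ - latticePt l) :=
    ContDiff.sum fun l _ => hη.smooth.comp (contDiff_id.sub contDiff_const)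
  refine hsum.contDiffAt.congr_of_eventuallyEq ?_
  filter_upwards [Metric.ball_mem_nhds ξ₀ one_pos] with ξ hξ
  exact tsum_eq_sum fun l hl => hη.eq_zero_of_notMem_nearLattice (mem_ball_iff_norm.mp hξ) hl

lemma one_le_translateSum (hη : IsUniformBump η) (ξ : Rn n) : 1 ≤ translateSum η ξ := by
  let nearest : Fin n → ℤ := fun i => round (ξ i)
  have hnearest : η (ξ - latticePt nearest) = 1 := hη.eq_one _ fun i => abs_sub_round (ξ i)
  have hsum : Summable fun l : Fin n → ℤ => η (ξ - latticePt l) :=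
    summable_of_ne_finset_zero (s := nearLattice ξ) fun l hl =>
      hη.eq_zero_of_notMem_nearLattice (by simp) hl
  exact hnearest.ge.trans (hsum.le_tsum nearest fun l _ => (hη.mem_Icc _).1)

lemma contDiff_uniformSymbol (hη : IsUniformBump η) (k : Fin n → ℤ) :
    ContDiff ℝ ∞ (uniformSymbol η k) :=
  (hη.smooth.comp (contDiff_id.sub contDiff_const)).div hη.contDiff_translateSum fun ξ =>
    (one_pos.trans_le (hη.one_le_translateSum ξ)).ne'

lemma ne_zero_of_uniformSymbol_ne_zero {k : Fin n → ℤ} {ξ : Rn n} (h : uniformSymbol η k ξ ≠ 0) :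
    η (ξ - latticePt k) ≠ 0 :=
  (div_ne_zero_iff.mp h).1

lemma hasCompactSupport_uniformSymbol (hη : IsUniformBump η) (k : Fin n → ℤ) :
    HasCompactSupport (uniformSymbol η k) := by
  refine HasCompactSupport.of_support_subset_isCompact
    (isCompact_closedBall (latticePt k) (n * (3 / 4))) fun ξ hξ => ?_
  rw [mem_closedBall_iff_norm]
  exact norm_le_of_forall_abs_le fun i =>
    (hη.abs_lt_of_ne_zero (ne_zero_of_uniformSymbol_ne_zero hξ) i).le

lemma abs_intCast_le_of_ne_zero (hη : IsUniformBump η) {k : Fin n → ℤ} {ξ : Rn n}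
    (h : η (ξ - latticePt k) ≠ 0) (i : Fin n) : |(k i : ℝ)| ≤ 4 * ‖ξ‖ := by
  have hlt := hη.abs_lt_of_ne_zero h i
  rw [PiLp.sub_apply, latticePt_apply, abs_sub_comm] at hlt
  have hle := abs_sub_abs_le_abs_sub (k i : ℝ) (ξ i)
  have hξ := abs_apply_le_norm ξ i
  rcases eq_or_ne (k i) 0 with hk | hk
  · rw [hk, Int.cast_zero, abs_zero]
    positivity
  · have hk_one : (1 : ℝ) ≤ |(k i : ℝ)| := by exact_mod_cast Int.one_le_abs hk
    linarith

lemma eq_zero_of_ne_zero (hη : IsUniformBump η) {k : Fin n → ℤ} {ξ : Rn n}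
    (h : η (ξ - latticePt k) ≠ 0) (hξ : ‖ξ‖ < 1 / 4) : k = 0 := by
  ext i
  have hlt : |(k i : ℝ)| < 1 := (hη.abs_intCast_le_of_ne_zero h i).trans_lt (by linarith)
  exact Int.abs_lt_one_iff.mp (by exact_mod_cast hlt)

lemma uniformSymbol_zero_eq_one (hη : IsUniformBump η) {ξ : Rn n} (hξ : ‖ξ‖ < 1 / 4) :
    uniformSymbol η 0 ξ = 1 := by
  have hη_one : η (ξ - latticePt 0) = 1 := by
    rw [latticePt_zero, sub_zero]
    exact hη.eq_one ξ fun i => (abs_apply_le_norm ξ i).trans (by linarith)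
  have hsum : translateSum η ξ = 1 := by
    rw [← hη_one]
    exact tsum_eq_single 0 fun l hl => by_contra fun h => hl (hη.eq_zero_of_ne_zero h hξ)
  rw [uniformSymbol_eq_div, hsum, hη_one, div_one]

lemma one_add_norm_latticePt_le (hη : IsUniformBump η) {k : Fin n → ℤ} (hk : k ≠ 0) {ξ : Rn n}
    (h : η (ξ - latticePt k) ≠ 0) : 1 + ‖latticePt k‖ ≤ ‖ξ‖ * (8 * n) := by
  obtain ⟨i, hi⟩ := Function.ne_iff.mp hk
  have hn : (1 : ℝ) ≤ n := by exact_mod_cast i.pos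
  have hk_one : (1 : ℝ) ≤ |(k i : ℝ)| := by exact_mod_cast Int.one_le_abs hi
  have hξ : 1 ≤ 4 * ‖ξ‖ := hk_one.trans (hη.abs_intCast_le_of_ne_zero h i)
  have hnorm : ‖latticePt k‖ ≤ n * (4 * ‖ξ‖) :=
    norm_le_of_forall_abs_le (hη.abs_intCast_le_of_ne_zero h)
  nlinarith

lemma exists_norm_iteratedFDeriv_uniformSymbol_le (hη : IsUniformBump η) :
    ∃ K : ℕ → ℝ, ∀ k j ξ, ‖iteratedFDeriv ℝ j (fun ξ => (uniformSymbol η k ξ : ℂ)) ξ‖ ≤ K j := by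
  obtain ⟨K, hK⟩ := exists_norm_iteratedFDeriv_le
    (contDiff_ofReal_comp (hη.contDiff_uniformSymbol 0))
    (hasCompactSupport_ofReal_comp (hη.hasCompactSupport_uniformSymbol 0))
  refine ⟨K, fun k j ξ => ?_⟩
  simp_rw [uniformSymbol_eq_comp_sub η k]
  rw [iteratedFDeriv_comp_sub (f := fun ξ => (uniformSymbol η 0 ξ : ℂ))]
  exact hK j _

theorem isSymbolFamily [NeZero n] (hη : IsUniformBump η) :
    IsSymbolFamily 0 (fun k ξ => (uniformSymbol η k ξ : ℂ))
      (fun k : Fin n → ℤ => (1 + ‖latticePt k‖) / (8 * n)) where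
  contDiff k := contDiff_ofReal_comp (hη.contDiff_uniformSymbol k)
  hasCompactSupport k := hasCompactSupport_ofReal_comp (hη.hasCompactSupport_uniformSymbol k)
  exists_bound := hη.exists_norm_iteratedFDeriv_uniformSymbol_le
  pos k := by
    have := NeZero.pos n
    positivity
  le_one := by
    have hn : (1 : ℝ) ≤ n := by exact_mod_cast NeZero.one_le
    rw [latticePt_zero, norm_zero, add_zero, div_le_one (by positivity)]
    linarith
  eq_zero k hk ξ hξ := by
    have hn : (0 : ℝ) < n := by exact_mod_cast NeZero.pos n
    rw [lt_div_iff₀ (by positivity)] at hξ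
    by_contra h
    exact hξ.not_ge (hη.one_add_norm_latticePt_le hk
      (ne_zero_of_uniformSymbol_ne_zero (Complex.ofReal_ne_zero.mp h)))
  eq_one ξ hξ := by
    have hn : (1 : ℝ) ≤ n := by exact_mod_cast NeZero.one_le
    rw [latticePt_zero, norm_zero, add_zero] at hξ
    rw [hη.uniformSymbol_zero_eq_one, Complex.ofReal_one]
    refine hξ.trans_le ?_
    gcongr
    linarith

end IsUniformBump

end Uniform

section Modulation

variable {n : ℕ}

lemma latticePt_mem_span_basisFun (k : Fin n → ℤ) :
    latticePt k ∈
      Submodule.span ℤ (Set.range (EuclideanSpace.basisFun (Fin n) ℝ).toBasis) := by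
  have hsum : latticePt k = ∑ i, k i • (EuclideanSpace.basisFun (Fin n) ℝ).toBasis i := by
    ext j
    simp [latticePt_apply, Pi.single_apply]
  rw [hsum]
  exact Submodule.sum_mem _ fun i _ =>
    Submodule.smul_mem _ _ (Submodule.subset_span (Set.mem_range_self i))

lemma summable_norm_rpow_of_mem_span {E ι κ : Type*} [NormedAddCommGroup E] [NormedSpace ℝ E]
    [Finite ι] (b : Module.Basis ι ℝ E) {f : κ → E} (hf : Function.Injective f)
    (hmem : ∀ k, f k ∈ Submodule.span ℤ (Set.range b)) {r : ℝ} (hr : r < -Module.finrank ℝ E) :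
    Summable fun k => ‖f k‖ ^ r := by
  have : FiniteDimensional ℝ E := b.finiteDimensional_of_finite
  have hsum : Summable fun z : Submodule.span ℤ (Set.range b) => ‖z‖ ^ r :=
    ZLattice.summable_norm_rpow _ r (by rwa [ZLattice.rank ℝ])
  have hinj : Function.Injective (Set.codRestrict f _ hmem) := hf.codRestrict hmem
  exact (hsum.comp_injective hinj).congr fun _ => rfl

lemma summable_norm_latticePt_rpow {r : ℝ} (hr : r < -n) :
    Summable fun k : Fin n → ℤ => ‖latticePt k‖ ^ r :=
  summable_norm_rpow_of_mem_span (EuclideanSpace.basisFun (Fin n) ℝ).toBasis latticePt_injective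
    latticePt_mem_span_basisFun (by rwa [finrank_euclideanSpace_fin])

lemma summable_one_add_norm_latticePt_rpow {r : ℝ} (hr : r < -n) :
    Summable fun k : Fin n → ℤ => (1 + ‖latticePt k‖) ^ r := by
  refine (summable_norm_latticePt_rpow hr).of_norm_bounded_eventually ?_
  filter_upwards [(Set.finite_singleton (0 : Fin n → ℤ)).compl_mem_cofinite] with k hk
  have hpos : 0 < ‖latticePt k‖ :=
    norm_pos_iff.mpr fun h => hk (latticePt_injective (h.trans latticePt_zero.symm))
  rw [Real.norm_of_nonneg (by positivity)]
  exact Real.rpow_le_rpow_of_nonpos hpos (by linarith) (hr.le.trans (by simp))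

lemma summable_inv_one_add_norm_latticePt_pow_rpow {m : ℕ} {r : ℝ} (hm : n < m * r) :
    Summable fun k : Fin n → ℤ => (((1 + ‖latticePt k‖) ^ m)⁻¹) ^ r := by
  have hrpow (k : Fin n → ℤ) :
      (((1 + ‖latticePt k‖) ^ m)⁻¹) ^ r = (1 + ‖latticePt k‖) ^ (-(m * r)) := by
    rw [← Real.rpow_natCast, ← Real.rpow_neg (by positivity), ← Real.rpow_mul (by positivity),
      neg_mul]
  simp_rw [hrpow]
  exact summable_one_add_norm_latticePt_rpow (neg_lt_neg hm)

lemma one_add_sq_rpow_half_le {x : ℝ} (hx : 0 ≤ x) (s : ℝ) :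
    (1 + x ^ 2) ^ (s / 2) ≤ (1 + x) ^ ⌈|s|⌉₊ :=
  calc (1 + x ^ 2) ^ (s / 2) ≤ (1 + x ^ 2) ^ ((⌈|s|⌉₊ : ℝ) / 2) := by
        gcongr
        · nlinarith
        · exact (le_abs_self s).trans (Nat.le_ceil _)
    _ ≤ ((1 + x) ^ 2) ^ ((⌈|s|⌉₊ : ℝ) / 2) := by
        refine Real.rpow_le_rpow (by positivity) (by nlinarith) (by positivity)
    _ = (1 + x) ^ ⌈|s|⌉₊ := by
        rw [← Real.rpow_natCast, ← Real.rpow_mul (by positivity), Nat.cast_ofNat,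
          mul_div_cancel₀ _ two_ne_zero, Real.rpow_natCast]

lemma one_add_sq_rpow_half_mul_le {x : ℝ} (hx : 0 ≤ x) {a : ℝ} (ha : 0 ≤ a) (s : ℝ) (m : ℕ) :
    (1 + x ^ 2) ^ (s / 2) * ((1 + x) / a)⁻¹ ^ (⌈|s|⌉₊ + m) ≤
      ((1 + x) ^ m)⁻¹ * a ^ (⌈|s|⌉₊ + m) :=
  calc (1 + x ^ 2) ^ (s / 2) * ((1 + x) / a)⁻¹ ^ (⌈|s|⌉₊ + m)
      ≤ (1 + x) ^ ⌈|s|⌉₊ * ((1 + x) / a)⁻¹ ^ (⌈|s|⌉₊ + m) := by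
        gcongr
        exact one_add_sq_rpow_half_le hx s
    _ = ((1 + x) ^ m)⁻¹ * a ^ (⌈|s|⌉₊ + m) := by
        have hx' : (1 + x) ^ ⌈|s|⌉₊ ≠ 0 := by positivity
        rw [inv_div, div_pow, pow_add (1 + x)]
        field_simp

lemma lqNorm_uniform_ne_top {q : ℝ≥0∞} (hq : 0 < q) (s : ℝ) {m : ℕ} (hm : n / q.toReal < m) :
    lqNorm q (fun k : Fin n → ℤ => ENNReal.ofReal ((1 + ‖latticePt k‖ ^ 2) ^ (s / 2)) *
      ENNReal.ofReal (((1 + ‖latticePt k‖) / (8 * n))⁻¹ ^ (⌈|s|⌉₊ + m))) ≠ ⊤ := by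
  refine lqNorm_ne_top_of_le hq (b := fun k : Fin n → ℤ => ((1 + ‖latticePt k‖) ^ m)⁻¹)
    (B := (8 * n) ^ (⌈|s|⌉₊ + m)) (fun k => by positivity)
    (fun k => inv_le_one_of_one_le₀ (one_le_pow₀ (by simp)))
    (fun hq_top => summable_inv_one_add_norm_latticePt_pow_rpow
      ((div_lt_iff₀ (ENNReal.toReal_pos hq.ne' hq_top)).mp hm)) fun k => ?_
  rw [← ENNReal.ofReal_mul (by positivity)]
  exact ENNReal.ofReal_le_ofReal
    (one_add_sq_rpow_half_mul_le (norm_nonneg _) (by positivity) s m)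

theorem IsUniformBump.isAdmissibleNorm_modulationNorm [NeZero n] {η : Rn n → ℝ}
    (hη : IsUniformBump η) (p : ℝ≥0∞) {q : ℝ≥0∞} (hq : 0 < q) (s : ℝ) :
    IsAdmissibleNorm p (modulationNorm η p q s) := by
  obtain ⟨m, hm⟩ := exists_nat_gt (n / q.toReal)
  have hm_pos : 0 < m := Nat.cast_pos.mp (lt_of_le_of_lt (by positivity) hm)
  exact hη.isSymbolFamily.isAdmissibleNorm_lqLpNorm
    (w := fun k : Fin n → ℤ => ENNReal.ofReal ((1 + ‖latticePt k‖ ^ 2) ^ (s / 2))) hq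
    (by simp [latticePt_zero]) (Nat.add_pos_right _ hm_pos).ne' (lqNorm_uniform_ne_top hq s hm)

end Modulation

/-! ### Logarithmic polar coordinates -/

section LogPolar

/-- The measure `e^{dτ} dτ` on the real line, which is the radial part of Lebesgue measure on a
`d`-dimensional space in the coordinate `τ = log ‖x‖`. -/
def logMeasure (d : ℕ) : Measure ℝ :=
  volume.withDensity fun τ => ENNReal.ofReal (Real.exp (d * τ))

instance (d : ℕ) : SFinite (logMeasure d) := by unfold logMeasure; infer_instance

lemma ae_logMeasure_iff {d : ℕ} {P : ℝ → Prop} :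
    (∀ᵐ τ ∂logMeasure d, P τ) ↔ ∀ᵐ τ, P τ := by
  rw [logMeasure, ae_withDensity_iff (by fun_prop)]
  simp [Real.exp_pos]

lemma measurePreserving_expOrderIso (d : ℕ) :
    MeasurePreserving Real.expOrderIso.toHomeomorph (logMeasure (d + 1))
      (Measure.volumeIoiPow d) := by
  let e := Real.expOrderIso.toHomeomorph
  refine ⟨e.measurable, ?_⟩
  ext B hB
  have himage : Real.exp '' (e ⁻¹' B) = Subtype.val '' B :=
    (Set.image_image Subtype.val e (e ⁻¹' B)).symm.trans (congrArg _ (e.image_preimage B))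
  rw [Measure.map_apply e.measurable hB, logMeasure, withDensity_apply _ (e.measurable hB),
    Measure.volumeIoiPow, withDensity_apply _ hB,
    setLIntegral_subtype measurableSet_Ioi _ fun r : ℝ => ENNReal.ofReal (r ^ d), ← himage,
    lintegral_image_eq_lintegral_abs_deriv_mul (e.measurable hB)
      (fun τ _ => (Real.hasDerivAt_exp τ).hasDerivWithinAt) Real.exp_injective.injOn]
  congr 1 with τ
  rw [← ENNReal.ofReal_mul (abs_nonneg _), abs_of_pos (Real.exp_pos _), ← pow_succ',
    ← Real.exp_nat_mul]

variable {E : Type*} [NormedAddCommGroup E]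

variable (E) in
/-- The annulus `{x | |log ‖x‖| ≤ M}`. -/
def logAnnulus (M : ℝ) : Set E :=
  Metric.closedBall 0 (Real.exp M) \ Metric.ball 0 (Real.exp (-M))

lemma mem_logAnnulus {M : ℝ} {x : E} (hx : x ≠ 0) :
    x ∈ logAnnulus E M ↔ |Real.log ‖x‖| ≤ M := by
  rw [abs_le, Real.le_log_iff_exp_le (norm_pos_iff.mpr hx),
    Real.log_le_iff_le_exp (norm_pos_iff.mpr hx)]
  simp [logAnnulus, and_comm]

lemma zero_notMem_logAnnulus (M : ℝ) : (0 : E) ∉ logAnnulus E M := fun h =>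
  h.2 (Metric.mem_ball_self (Real.exp_pos _))

variable (E) in
lemma isCompact_logAnnulus [ProperSpace E] (M : ℝ) : IsCompact (logAnnulus E M) :=
  (isCompact_closedBall _ _).diff Metric.isOpen_ball

variable [NormedSpace ℝ E]

/-- Logarithmic polar coordinates `(θ, τ) ↦ e^τ θ`. -/
def logPolar (z : Metric.sphere (0 : E) 1 × ℝ) : E := Real.exp z.2 • (z.1 : E)

lemma norm_logPolar (z : Metric.sphere (0 : E) 1 × ℝ) : ‖logPolar z‖ = Real.exp z.2 := by
  simp [logPolar, norm_smul]

lemma log_norm_logPolar (z : Metric.sphere (0 : E) 1 × ℝ) : Real.log ‖logPolar z‖ = z.2 := by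
  rw [norm_logPolar, Real.log_exp]

/-- The density with respect to `dτ` of the push-forward of `Φ μ` under `y ↦ log ‖y‖`. -/
def radialDensity [MeasurableSpace E] (μ : Measure E) (Φ : E → ℂ) (τ : ℝ) : ℂ :=
  Real.exp (Module.finrank ℝ E * τ) •
    ∫ θ : Metric.sphere (0 : E) 1, Φ (logPolar (θ, τ)) ∂μ.toSphere

lemma toReal_smul_integral_logPolar [MeasurableSpace E] (μ : Measure E) (Φ : E → ℂ) (b : ℝ → ℂ)
    (τ : ℝ) :
    (ENNReal.ofReal (Real.exp (Module.finrank ℝ E * τ))).toReal •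
      ∫ θ, Φ (logPolar (θ, τ)) * b τ ∂μ.toSphere = radialDensity μ Φ τ * b τ := by
  rw [integral_mul_const, ENNReal.toReal_ofReal (Real.exp_pos _).le, radialDensity, smul_mul_assoc]

variable [FiniteDimensional ℝ E] [MeasurableSpace E] [BorelSpace E]

lemma measurableEmbedding_logPolar : MeasurableEmbedding (logPolar (E := E)) := by
  let e : Metric.sphere (0 : E) 1 × ℝ ≃ₜ ({0}ᶜ : Set E) :=
    ((Homeomorph.refl _).prodCongr Real.expOrderIso.toHomeomorph).trans
      (homeomorphUnitSphereProd E).symm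
  exact (MeasurableEmbedding.subtype_coe (measurableSet_singleton (0 : E)).compl).comp
    e.measurableEmbedding

variable [Nontrivial E] (μ : Measure E) [μ.IsAddHaarMeasure]

lemma ae_ne_zero : ∀ᵐ x ∂μ, x ≠ 0 := by
  simp [ae_iff]

lemma measurePreserving_subtype_val_compl_zero :
    MeasurePreserving (Subtype.val : ({0}ᶜ : Set E) → E) (μ.comap Subtype.val) μ := by
  have hval := MeasurePreserving.mk measurable_subtype_coe
    (map_comap_subtype_coe (measurableSet_singleton (0 : E)).compl μ)
  rwa [Measure.restrict_eq_self_of_ae_mem (s := {0}ᶜ) (ae_ne_zero μ)] at hval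

theorem measurePreserving_logPolar :
    MeasurePreserving (logPolar (E := E))
      (μ.toSphere.prod (logMeasure (Module.finrank ℝ E))) μ := by
  obtain ⟨d, hd⟩ := Nat.exists_eq_succ_of_ne_zero (Module.finrank_pos (R := ℝ) (M := E)).ne'
  have hexp : MeasurePreserving (Prod.map id Real.expOrderIso.toHomeomorph)
      (μ.toSphere.prod (logMeasure (d + 1))) (μ.toSphere.prod (Measure.volumeIoiPow d)) :=
    (MeasurePreserving.id _).prod (measurePreserving_expOrderIso d)
  have hpolar := μ.measurePreserving_homeomorphUnitSphereProd
  rw [hd, Nat.succ_sub_one] at hpolar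
  rw [hd]
  exact (measurePreserving_subtype_val_compl_zero μ).comp
    ((MeasurePreserving.symm (homeomorphUnitSphereProd E).toMeasurableEquiv hpolar).comp hexp)

theorem ae_comp_log_norm_iff {P : ℝ → Prop} : (∀ᵐ x ∂μ, P (Real.log ‖x‖)) ↔ ∀ᵐ τ, P τ := by
  have : NeZero μ.toSphere := ⟨μ.toSphere_ne_zero⟩
  rw [← (measurePreserving_logPolar μ).map_eq, measurableEmbedding_logPolar.ae_map_iff]
  simp only [log_norm_logPolar]
  rw [← ae_logMeasure_iff]
  exact ⟨fun h => (Measure.ae_ae_of_ae_prod h).exists.choose_spec,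
    fun h => Measure.quasiMeasurePreserving_snd.ae h⟩

theorem lintegral_comp_log_norm_le {G : ℝ → ℝ≥0∞} (hG : Measurable G) {M : ℝ}
    (hM : ∀ τ, M < τ → G τ = 0) :
    ∫⁻ x, G (Real.log ‖x‖) ∂μ ≤
      μ.toSphere Set.univ * ENNReal.ofReal (Real.exp (Module.finrank ℝ E * M)) * ∫⁻ τ, G τ := by
  rw [← (measurePreserving_logPolar μ).lintegral_comp_emb measurableEmbedding_logPolar]
  simp only [log_norm_logPolar]
  rw [lintegral_prod _ (by fun_prop)]
  simp only [lintegral_const]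
  rw [mul_comm, mul_assoc, logMeasure,
    lintegral_withDensity_eq_lintegral_mul _ (by fun_prop) hG, ← lintegral_const_mul _ hG]
  gcongr _ * ?_
  refine lintegral_mono fun τ => ?_
  rcases le_or_gt τ M with hτ | hτ
  · rw [Pi.mul_apply]
    gcongr
  · simp [hM τ hτ]

variable {μ}

section Integral

variable {Φ : E → ℂ} {b : ℝ → ℂ}

lemma integrable_mul_comp_logPolar (h : Integrable (fun y => Φ y * b (Real.log ‖y‖)) μ) :
    Integrable (fun z : Metric.sphere (0 : E) 1 × ℝ => Φ (logPolar z) * b z.2)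
      (μ.toSphere.prod (logMeasure (Module.finrank ℝ E))) := by
  simpa only [Function.comp_def, log_norm_logPolar] using
    ((measurePreserving_logPolar μ).integrable_comp_emb measurableEmbedding_logPolar).mpr h

theorem integrable_radialDensity_mul (h : Integrable (fun y => Φ y * b (Real.log ‖y‖)) μ) :
    Integrable fun τ => radialDensity μ Φ τ * b τ := by
  have hint := (integrable_mul_comp_logPolar h).integral_prod_right
  rw [logMeasure, integrable_withDensity_iff_integrable_smul' (by fun_prop)
    (Eventually.of_forall fun _ => ENNReal.ofReal_lt_top)] at hint
  simpa only [toReal_smul_integral_logPolar] using hint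

theorem integral_mul_comp_log_norm (h : Integrable (fun y => Φ y * b (Real.log ‖y‖)) μ) :
    ∫ y, Φ y * b (Real.log ‖y‖) ∂μ = ∫ τ, radialDensity μ Φ τ * b τ := by
  rw [← (measurePreserving_logPolar μ).integral_comp measurableEmbedding_logPolar]
  simp only [log_norm_logPolar]
  rw [integral_prod_symm _ (integrable_mul_comp_logPolar h), logMeasure,
    integral_withDensity_eq_integral_toReal_smul (by fun_prop)
      (Eventually.of_forall fun _ => ENNReal.ofReal_lt_top)]
  simp only [toReal_smul_integral_logPolar]

lemma integrable_mul_comp_log_norm (hΦ : LocallyIntegrableOn Φ {0}ᶜ μ) (hb : Measurable b)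
    {B M : ℝ} (hB : ∀ τ, ‖b τ‖ ≤ B) (hM : ∀ τ, b τ ≠ 0 → |τ| ≤ M) :
    Integrable (fun y => Φ y * b (Real.log ‖y‖)) μ := by
  have : ProperSpace E := FiniteDimensional.proper ℝ E
  have hcompact := isCompact_logAnnulus E M
  have hΦ_annulus : Integrable ((logAnnulus E M).indicator Φ) μ :=
    (hΦ.integrableOn_compact_subset (Set.subset_compl_singleton_iff.mpr (zero_notMem_logAnnulus M))
      hcompact).integrable_indicator hcompact.measurableSet
  have hb_log : Measurable fun y : E => b (Real.log ‖y‖) :=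
    hb.comp (Real.measurable_log.comp measurable_norm)
  refine (hΦ_annulus.mul_bdd hb_log.aestronglyMeasurable
    (Eventually.of_forall fun y => hB _)).congr ?_
  filter_upwards [ae_ne_zero μ] with y hy
  by_cases hb_zero : b (Real.log ‖y‖) = 0
  · rw [hb_zero, mul_zero, mul_zero]
  · rw [Set.indicator_of_mem ((mem_logAnnulus hy).mpr (hM _ hb_zero))]

theorem locallyIntegrable_radialDensity (hΦ : LocallyIntegrableOn Φ {0}ᶜ μ) :
    LocallyIntegrable (radialDensity μ Φ) := by
  rw [locallyIntegrable_iff]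
  intro K hK
  obtain ⟨M, hM⟩ := hK.isBounded.exists_norm_le
  have hint : Integrable fun τ => radialDensity μ Φ τ * K.indicator 1 τ :=
    integrable_radialDensity_mul <| integrable_mul_comp_log_norm hΦ
      (measurable_one.indicator hK.measurableSet) (B := 1)
      (fun τ => (norm_indicator_le_norm_self _ _).trans (by simp))
      fun τ hτ => hM τ (Set.mem_of_indicator_ne_zero hτ)
  rw [← integrable_indicator_iff hK.measurableSet]
  simpa only [← Set.indicator_mul_right, Pi.one_apply, mul_one] using hint

end Integral

theorem isZeroOp_of_radialDensity_ae_eq_zero {n : ℕ} [NeZero n] {Φ : Rn n → ℂ}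
    (h : ∀ᵐ τ, radialDensity volume Φ τ = 0) : IsZeroOp Φ := by
  intro f hf
  filter_upwards [hf.2] with x hx
  have hlog : (fun y => Φ y * f (‖y‖⁻¹ • x)) =ᵐ[volume]
      fun y => Φ y * (fun τ => f (Real.exp (-τ) • x)) (Real.log ‖y‖) := by
    filter_upwards [ae_ne_zero volume] with y hy
    simp only [Real.exp_neg, Real.exp_log (norm_pos_iff.mpr hy)]
  rw [hausdorff, integral_congr_ae hlog, integral_mul_comp_log_norm
    (b := fun τ => f (Real.exp (-τ) • x)) (hx.congr hlog)]
  refine integral_eq_zero_of_ae ?_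
  filter_upwards [h] with τ hτ
  rw [hτ, zero_mul, Pi.zero_apply]

end LogPolar

/-! ### Radial test functions -/

section RadialTest

lemma eLpNorm_le_eLpNorm_mul_rpow_measure_of_support_subset {α F : Type*} [MeasurableSpace α]
    [NormedAddCommGroup F] {μ : Measure α} {f : α → F} (hf : AEStronglyMeasurable f μ)
    {S : Set α} (hS : f.support ⊆ S) {p q : ℝ≥0∞} (hpq : p ≤ q) :
    eLpNorm f p μ ≤ eLpNorm f q μ * μ S ^ (1 / p.toReal - 1 / q.toReal) := by
  simpa only [eLpNorm_restrict_eq_of_support_subset hS, Measure.restrict_apply_univ] using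
    eLpNorm_le_eLpNorm_mul_rpow_measure_univ (μ := μ.restrict S) hpq hf.restrict

variable {n : ℕ}

lemma comp_log_norm_mem_testAwayFromZero {g : ℝ → ℂ} (hg : ContDiff ℝ ∞ g)
    (hg_compact : HasCompactSupport g) (hg_zero : g 0 = 0) :
    (fun x : Rn n => g (Real.log ‖x‖)) ∈ testAwayFromZero n := by
  obtain ⟨M, hM⟩ := hg_compact.isCompact.isBounded.exists_norm_le
  have hsupport : tsupport (fun x : Rn n => g (Real.log ‖x‖)) ⊆ logAnnulus (Rn n) M := by
    refine closure_minimal (fun x hx => ?_) (isCompact_logAnnulus _ M).isClosed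
    have hx_ne : x ≠ 0 := by
      rintro rfl
      exact hx (by simpa only [norm_zero, Real.log_zero] using hg_zero)
    exact (mem_logAnnulus hx_ne).mpr (hM _ (subset_tsupport _ hx))
  refine ⟨contDiff_iff_contDiffAt.mpr fun x => ?_,
    (isCompact_logAnnulus _ M).of_isClosed_subset (isClosed_tsupport _) hsupport,
    fun h => zero_notMem_logAnnulus M (hsupport h)⟩
  by_cases hx : x ∈ tsupport fun x : Rn n => g (Real.log ‖x‖)
  swap
  · exact contDiffAt_const.congr_of_eventuallyEq (notMem_tsupport_iff_eventuallyEq.mp hx)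
  have hx_ne : x ≠ 0 := fun h => zero_notMem_logAnnulus M (h ▸ hsupport hx)
  exact hg.contDiffAt.comp x
    ((contDiffAt_norm ℝ hx_ne).log (norm_ne_zero_iff.mpr hx_ne))

section Hausdorff

variable [NeZero n] {Φ : Rn n → ℂ} {g : ℝ → ℂ}

theorem hausdorff_comp_log_norm (hΦ : LocallyIntegrableOn Φ {0}ᶜ volume) (hg : Continuous g)
    (hg_compact : HasCompactSupport g) {x : Rn n} (hx : x ≠ 0) :
    hausdorff Φ (fun z => g (Real.log ‖z‖)) x =
      (radialDensity volume Φ ⋆[ContinuousLinearMap.mul ℝ ℂ] g) (Real.log ‖x‖) := by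
  let a := Real.log ‖x‖
  obtain ⟨B, hB⟩ := hg_compact.exists_bound_of_continuous hg
  obtain ⟨M, hM⟩ := hg_compact.isCompact.isBounded.exists_norm_le
  have hint : Integrable fun y => Φ y * g (a - Real.log ‖y‖) :=
    integrable_mul_comp_log_norm hΦ (b := fun τ => g (a - τ)) (M := |a| + M)
      (hg.measurable.comp (measurable_const.sub measurable_id)) (fun τ => hB _) fun τ hτ => by
        have hτ_le : |a - τ| ≤ M := hM _ (subset_tsupport g hτ)
        calc |τ| = |a - (a - τ)| := by rw [sub_sub_cancel]
          _ ≤ |a| + |a - τ| := abs_sub a _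
          _ ≤ |a| + M := by gcongr
  have hlog : (fun y => Φ y * g (Real.log ‖‖y‖⁻¹ • x‖)) =ᵐ[volume]
      fun y => Φ y * g (a - Real.log ‖y‖) := by
    filter_upwards [ae_ne_zero volume] with y hy
    rw [norm_smul, norm_inv, norm_norm, Real.log_mul (inv_ne_zero (norm_ne_zero_iff.mpr hy))
      (norm_ne_zero_iff.mpr hx), Real.log_inv, neg_add_eq_sub]
  rw [hausdorff, integral_congr_ae hlog,
    integral_mul_comp_log_norm (b := fun τ => g (a - τ)) hint]
  rfl

lemma continuousAt_hausdorff_comp_log_norm (hΦ : LocallyIntegrableOn Φ {0}ᶜ volume)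
    (hg : Continuous g) (hg_compact : HasCompactSupport g) {x : Rn n} (hx : x ≠ 0) :
    ContinuousAt (hausdorff Φ fun z => g (Real.log ‖z‖)) x := by
  have hconv : Continuous (radialDensity volume Φ ⋆[ContinuousLinearMap.mul ℝ ℂ] g) :=
    hg_compact.continuous_convolution_right _ (locallyIntegrable_radialDensity hΦ) hg
  refine ContinuousAt.congr (f := fun z =>
    (radialDensity volume Φ ⋆[ContinuousLinearMap.mul ℝ ℂ] g) (Real.log ‖z‖))
    (hconv.continuousAt.comp (continuousAt_id.norm.log (norm_ne_zero_iff.mpr hx))) ?_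
  filter_upwards [isOpen_ne.mem_nhds hx] with z hz
  exact (hausdorff_comp_log_norm hΦ hg hg_compact hz).symm

end Hausdorff

section ShiftedBump

variable (β : ContDiffBump (0 : ℝ))

/-- A bump function on the line of integral `1`, centred at `1` instead of `0` so that it vanishes
at `Real.log ‖0‖ = 0` once its outer radius is at most `1`. -/
def shiftedBump (τ : ℝ) : ℂ := β.normed volume (τ - 1)

lemma contDiff_shiftedBump : ContDiff ℝ ∞ (shiftedBump β) :=
  Complex.ofRealCLM.contDiff.comp (β.contDiff_normed.comp (contDiff_id.sub contDiff_const))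

lemma support_shiftedBump_subset : (shiftedBump β).support ⊆ Metric.closedBall 1 β.rOut := by
  intro τ hτ
  have hτ_mem : τ - 1 ∈ Metric.ball 0 β.rOut := by
    rw [← β.support_normed_eq (μ := volume)]
    simpa [shiftedBump] using hτ
  rw [mem_ball_zero_iff] at hτ_mem
  exact hτ_mem.le

lemma hasCompactSupport_shiftedBump : HasCompactSupport (shiftedBump β) :=
  HasCompactSupport.of_support_subset_isCompact (isCompact_closedBall _ _)
    (support_shiftedBump_subset β)

lemma shiftedBump_apply_zero {β : ContDiffBump (0 : ℝ)} (hβ : β.rOut ≤ 1) :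
    shiftedBump β 0 = 0 := by
  simp [shiftedBump, β.normed_def, β.zero_of_le_dist (x := -1) (by simpa using hβ)]

lemma lintegral_enorm_shiftedBump : ∫⁻ τ, ‖shiftedBump β τ‖ₑ = 1 := by
  have henorm (τ : ℝ) : ‖shiftedBump β τ‖ₑ = ENNReal.ofReal (β.normed volume (τ - 1)) := by
    rw [shiftedBump, ← ofReal_norm, Complex.norm_real, Real.norm_of_nonneg (β.nonneg_normed _)]
  simp only [henorm]
  rw [lintegral_sub_right_eq_self (fun τ => ENNReal.ofReal (β.normed volume τ)) 1,
    ← ofReal_integral_eq_lintegral_ofReal β.integrable_normed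
      (Eventually.of_forall β.nonneg_normed), β.integral_normed, ENNReal.ofReal_one]

lemma convolution_shiftedBump (A : ℝ → ℂ) (a : ℝ) :
    (A ⋆[ContinuousLinearMap.mul ℝ ℂ] shiftedBump β) a =
      (β.normed volume ⋆[ContinuousLinearMap.lsmul ℝ ℝ] A) (a - 1) := by
  rw [convolution_eq_swap (x := a - 1)]
  simp only [convolution_def, shiftedBump, ContinuousLinearMap.mul_apply',
    ContinuousLinearMap.lsmul_apply, Complex.real_smul, sub_right_comm, mul_comm]

end ShiftedBump

section NormEstimate

/-- The radial test function `x ↦ β(log ‖x‖ - 1)`. -/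
def radialTest (n : ℕ) (β : ContDiffBump (0 : ℝ)) (x : Rn n) : ℂ := shiftedBump β (Real.log ‖x‖)

lemma radialTest_mem_testAwayFromZero {β : ContDiffBump (0 : ℝ)} (hβ : β.rOut ≤ 1) :
    radialTest n β ∈ testAwayFromZero n :=
  comp_log_norm_mem_testAwayFromZero (contDiff_shiftedBump β) (hasCompactSupport_shiftedBump β)
    (shiftedBump_apply_zero hβ)

lemma shiftedBump_eq_zero_of_two_lt {β : ContDiffBump (0 : ℝ)} (hβ : β.rOut ≤ 1) {τ : ℝ}
    (hτ : 2 < τ) : shiftedBump β τ = 0 := by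
  by_contra h
  have hτ_le := (Real.closedBall_eq_Icc ▸ support_shiftedBump_subset β h).2
  linarith

variable (n) in
/-- The factor `|S^{n-1}| e^{2n}` which bounds the density of `log ‖x‖` on `(-∞, 2]`. -/
def shellConstant : ℝ≥0∞ :=
  (volume : Measure (Rn n)).toSphere Set.univ *
    ENNReal.ofReal (Real.exp (Module.finrank ℝ (Rn n) * 2))

lemma shellConstant_ne_top : shellConstant n ≠ ⊤ :=
  ENNReal.mul_ne_top (measure_ne_top _ _) ENNReal.ofReal_ne_top

variable [NeZero n]

lemma eLpNorm_one_radialTest_le {β : ContDiffBump (0 : ℝ)} (hβ : β.rOut ≤ 1) :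
    eLpNorm (radialTest n β) 1 volume ≤ shellConstant n := by
  rw [eLpNorm_one_eq_lintegral_enorm]
  refine (lintegral_comp_log_norm_le volume (G := fun τ => ‖shiftedBump β τ‖ₑ) (M := 2)
    (contDiff_shiftedBump β).continuous.enorm.measurable fun τ hτ => ?_).trans ?_
  · rw [shiftedBump_eq_zero_of_two_lt hβ hτ, enorm_zero]
  · rw [lintegral_enorm_shiftedBump, mul_one, shellConstant]

lemma volume_preimage_log_norm_closedBall_le {ε : ℝ} (hε : ε ≤ 1) :
    volume ((fun x : Rn n => Real.log ‖x‖) ⁻¹' Metric.closedBall 1 ε) ≤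
      shellConstant n * ENNReal.ofReal (2 * ε) := by
  have hmeas : Measurable fun x : Rn n => Real.log ‖x‖ := Real.measurable_log.comp measurable_norm
  rw [← lintegral_indicator_one (hmeas Metric.isClosed_closedBall.measurableSet),
    ← Real.volume_closedBall 1 ε,
    ← lintegral_indicator_one Metric.isClosed_closedBall.measurableSet]
  refine lintegral_comp_log_norm_le volume (measurable_one.indicator
    Metric.isClosed_closedBall.measurableSet) fun τ hτ => Set.indicator_of_notMem (fun h => ?_) _
  have hτ_le := (Real.closedBall_eq_Icc ▸ h).2
  linarith

lemma one_lt_one_div_toReal {p : ℝ≥0∞} (hp₀ : 0 < p) (hp₁ : p < 1) : 1 < 1 / p.toReal := by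
  have hp_top : p ≠ ⊤ := (hp₁.trans ENNReal.one_lt_top).ne
  exact one_lt_one_div (ENNReal.toReal_pos hp₀.ne' hp_top)
    ((ENNReal.toReal_lt_toReal hp_top ENNReal.one_ne_top).mpr hp₁)

lemma eLpNorm_radialTest_le {p : ℝ≥0∞} (hp₀ : 0 < p) (hp₁ : p < 1) {β : ContDiffBump (0 : ℝ)}
    (hβ : β.rOut ≤ 1) :
    eLpNorm (radialTest n β) p volume ≤
      shellConstant n * (shellConstant n * ENNReal.ofReal (2 * β.rOut)) ^ (1 / p.toReal - 1) := by
  have hsupport : (radialTest n β).support ⊆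
      (fun x => Real.log ‖x‖) ⁻¹' Metric.closedBall 1 β.rOut :=
    fun x hx => support_shiftedBump_subset β hx
  refine (eLpNorm_le_eLpNorm_mul_rpow_measure_of_support_subset
    (radialTest_mem_testAwayFromZero hβ).1.continuous.aestronglyMeasurable hsupport hp₁.le).trans ?_
  have hp_inv : 0 ≤ 1 / p.toReal - 1 := (sub_pos.mpr (one_lt_one_div_toReal hp₀ hp₁)).le
  rw [ENNReal.toReal_one, one_div_one]
  gcongr
  · exact eLpNorm_one_radialTest_le hβ
  · exact volume_preimage_log_norm_closedBall_le hβ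

theorem tendsto_eLpNorm_radialTest {p : ℝ≥0∞} (hp₀ : 0 < p) (hp₁ : p < 1)
    {β : ℕ → ContDiffBump (0 : ℝ)} (hβ : ∀ k, (β k).rOut ≤ 1)
    (hβ_tendsto : Tendsto (fun k => (β k).rOut) atTop (𝓝 0)) :
    Tendsto (fun k => eLpNorm (radialTest n (β k)) p volume) atTop (𝓝 0) := by
  have hp_inv : 0 < 1 / p.toReal - 1 := sub_pos.mpr (one_lt_one_div_toReal hp₀ hp₁)
  have hradius : Tendsto (fun k => ENNReal.ofReal (2 * (β k).rOut)) atTop (𝓝 0) := by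
    simpa using ENNReal.tendsto_ofReal (hβ_tendsto.const_mul 2)
  have hbound : Tendsto (fun k => shellConstant n *
      (shellConstant n * ENNReal.ofReal (2 * (β k).rOut)) ^ (1 / p.toReal - 1)) atTop (𝓝 0) := by
    simpa only [mul_zero, ENNReal.zero_rpow_of_pos hp_inv] using ENNReal.Tendsto.const_mul
      ((ENNReal.Tendsto.const_mul hradius (Or.inr (shellConstant_ne_top (n := n)))).ennrpow_const
        (1 / p.toReal - 1)) (Or.inr (shellConstant_ne_top (n := n)))
  exact tendsto_of_tendsto_of_tendsto_of_le_of_le tendsto_const_nhds hbound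
    (fun _ => zero_le) fun k => eLpNorm_radialTest_le hp₀ hp₁ (hβ k)

end NormEstimate

section Vanishing

/-- A sequence of bump functions on the line whose supports shrink to `{0}`. -/
def lineBump (k : ℕ) : ContDiffBump (0 : ℝ) where
  rIn := 1 / ((k : ℝ) + 1) / 2
  rOut := 1 / ((k : ℝ) + 1)
  rIn_pos := by positivity
  rIn_lt_rOut := half_lt_self (by positivity)

lemma rOut_lineBump_le_one (k : ℕ) : (lineBump k).rOut ≤ 1 := by
  simpa [lineBump] using Nat.one_div_le_one_div (α := ℝ) (Nat.zero_le k)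

lemma tendsto_rOut_lineBump : Tendsto (fun k => (lineBump k).rOut) atTop (𝓝 0) :=
  tendsto_one_div_add_atTop_nhds_zero_nat

lemma ae_tendsto_normed_lineBump_convolution {A : ℝ → ℂ} (hA : LocallyIntegrable A) :
    ∀ᵐ τ, Tendsto
      (fun k => ((lineBump k).normed volume ⋆[ContinuousLinearMap.lsmul ℝ ℝ] A) τ) atTop
      (𝓝 (A τ)) :=
  ContDiffBump.ae_convolution_tendsto_right_of_locallyIntegrable (K := 2) tendsto_rOut_lineBump
    (Eventually.of_forall fun _ => (mul_div_cancel₀ _ two_ne_zero).ge) hA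

variable [NeZero n] {Φ : Rn n → ℂ}

lemma hausdorff_radialTest (hΦ : LocallyIntegrableOn Φ {0}ᶜ volume) (β : ContDiffBump (0 : ℝ))
    {x : Rn n} (hx : x ≠ 0) :
    hausdorff Φ (radialTest n β) x =
      (β.normed volume ⋆[ContinuousLinearMap.lsmul ℝ ℝ] radialDensity volume Φ)
        (Real.log ‖x‖ - 1) :=
  (hausdorff_comp_log_norm hΦ (contDiff_shiftedBump β).continuous
    (hasCompactSupport_shiftedBump β) hx).trans (convolution_shiftedBump β _ _)

lemma ae_continuousAt_hausdorff_radialTest (hΦ : LocallyIntegrableOn Φ {0}ᶜ volume)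
    (β : ContDiffBump (0 : ℝ)) :
    ∀ᵐ x, ContinuousAt (hausdorff Φ (radialTest n β)) x :=
  (ae_ne_zero volume).mono fun _ hx => continuousAt_hausdorff_comp_log_norm hΦ
    (contDiff_shiftedBump β).continuous (hasCompactSupport_shiftedBump β) hx

lemma aestronglyMeasurable_hausdorff_radialTest (hΦ : LocallyIntegrableOn Φ {0}ᶜ volume)
    (β : ContDiffBump (0 : ℝ)) : AEStronglyMeasurable (hausdorff Φ (radialTest n β)) volume := by
  have hconv : Continuous
      (β.normed volume ⋆[ContinuousLinearMap.lsmul ℝ ℝ] radialDensity volume Φ) :=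
    β.hasCompactSupport_normed.continuous_convolution_left _
      (β.contDiff_normed (n := 0)).continuous (locallyIntegrable_radialDensity hΦ)
  have hlog : Measurable fun x : Rn n => Real.log ‖x‖ - 1 :=
    (Real.measurable_log.comp measurable_norm).sub_const 1
  exact (hconv.measurable.comp hlog).aestronglyMeasurable.congr
    ((ae_ne_zero volume).mono fun _ hx => (hausdorff_radialTest hΦ β hx).symm)

lemma ae_tendsto_hausdorff_radialTest (hΦ : LocallyIntegrableOn Φ {0}ᶜ volume) :
    ∀ᵐ x, Tendsto (fun k => hausdorff Φ (radialTest n (lineBump k)) x) atTop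
      (𝓝 (radialDensity volume Φ (Real.log ‖x‖ - 1))) := by
  have hconv := (ae_comp_log_norm_iff (volume : Measure (Rn n))).mpr <|
    (measurePreserving_sub_right volume (1 : ℝ)).quasiMeasurePreserving.ae
      (ae_tendsto_normed_lineBump_convolution (locallyIntegrable_radialDensity hΦ))
  filter_upwards [hconv, ae_ne_zero volume] with x hx hx_ne
  simpa only [hausdorff_radialTest hΦ _ hx_ne] using hx

theorem isZeroOp_of_eLpNorm_hausdorff_le {p : ℝ≥0∞} (hp₀ : 0 < p) (hp₁ : p < 1)
    (hΦ : LocallyIntegrableOn Φ {0}ᶜ volume) {C : ℝ≥0∞} (hC : C ≠ ⊤)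
    (h : ∀ f ∈ testAwayFromZero n, (∀ᵐ x, ContinuousAt (hausdorff Φ f) x) →
      eLpNorm (hausdorff Φ f) p volume ≤ C * eLpNorm f p volume) : IsZeroOp Φ := by
  let A := radialDensity volume Φ
  let f (k : ℕ) := radialTest n (lineBump k)
  have hmeas (k : ℕ) := aestronglyMeasurable_hausdorff_radialTest hΦ (lineBump k)
  have htendsto := ae_tendsto_hausdorff_radialTest hΦ
  have hnorm : eLpNorm (fun x : Rn n => A (Real.log ‖x‖ - 1)) p volume = 0 := by
    refine le_antisymm ?_ zero_le
    calc eLpNorm (fun x : Rn n => A (Real.log ‖x‖ - 1)) p volume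
        ≤ liminf (fun k => eLpNorm (hausdorff Φ (f k)) p volume) atTop :=
          Lp.eLpNorm_lim_le_liminf_eLpNorm hmeas _ htendsto
      _ ≤ liminf (fun k => C * eLpNorm (f k) p volume) atTop :=
          liminf_le_liminf <| Eventually.of_forall fun k =>
            h _ (radialTest_mem_testAwayFromZero (rOut_lineBump_le_one k))
              (ae_continuousAt_hausdorff_radialTest hΦ _)
      _ = 0 := by
          simpa only [mul_zero] using (ENNReal.Tendsto.const_mul (tendsto_eLpNorm_radialTest hp₀
            hp₁ rOut_lineBump_le_one tendsto_rOut_lineBump) (Or.inr hC)).liminf_eq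
  have hA_log : ∀ᵐ x : Rn n, A (Real.log ‖x‖ - 1) = 0 :=
    (eLpNorm_eq_zero_iff (aestronglyMeasurable_of_tendsto_ae atTop hmeas htendsto) hp₀.ne').mp hnorm
  have hA_sub : ∀ᵐ τ, A (τ - 1) = 0 :=
    (ae_comp_log_norm_iff volume (P := fun τ => A (τ - 1) = 0)).mp hA_log
  refine isZeroOp_of_radialDensity_ae_eq_zero ?_
  filter_upwards [(measurePreserving_add_right volume (1 : ℝ)).quasiMeasurePreserving.ae hA_sub]
    with τ hτ
  rwa [add_sub_cancel_right] at hτ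

end Vanishing

end RadialTest

section Main

variable {n : ℕ} {Φ : Rn n → ℂ} {𝒟 : Set (Rn n → ℂ)} {N : 𝓢'(Rn n, ℂ) → ℝ≥0∞}

lemma IsZeroOp.isBoundedOn (hz : IsZeroOp Φ) (h𝒟 : 𝒟 ⊆ hausdorffDomain Φ) (hN : N 0 = 0) :
    IsBoundedOn Φ 𝒟 N :=
  ⟨0, fun f hf _ _ _ => ⟨0, represents_zero_of_ae_eq_zero (hz f (h𝒟 hf)), by simp [hN]⟩⟩

theorem IsAdmissibleNorm.isBoundedOn_iff [NeZero n] {p : ℝ≥0∞} (hN : IsAdmissibleNorm p N)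
    (hp₀ : 0 < p) (hp₁ : p < 1) (hΦ : LocallyIntegrableOn Φ {0}ᶜ volume)
    (h𝒟_test : testAwayFromZero n ⊆ 𝒟) (h𝒟_dom : 𝒟 ⊆ hausdorffDomain Φ) :
    IsBoundedOn Φ 𝒟 N ↔ IsZeroOp Φ := by
  refine ⟨fun hb => ?_, fun hz => hz.isBoundedOn h𝒟_dom hN.map_zero⟩
  obtain ⟨C, hC, hbound⟩ := hN.exists_eLpNorm_hausdorff_le h𝒟_test hb
  exact isZeroOp_of_eLpNorm_hausdorff_le hp₀ hp₁ hΦ hC hbound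

end Main

end HausdorffOp

end

theorem mainTheorem3 (n : ℕ) (hn : 0 < n) (p q : ℝ≥0∞) (hp₀ : 0 < p) (hp₁ : p < 1) (hq : 0 < q)
    (s : ℝ) (φ : HausdorffOp.Rn n → ℝ) (hφ : HausdorffOp.IsDyadicBump φ)
    (η : HausdorffOp.Rn n → ℝ) (hη : HausdorffOp.IsUniformBump η)
    (Φ : HausdorffOp.Rn n → ℂ) (hΦ : LocallyIntegrableOn Φ {0}ᶜ volume)
    (𝒟 : Set (HausdorffOp.Rn n → ℂ)) (h𝒟_test : HausdorffOp.testAwayFromZero n ⊆ 𝒟)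
    (h𝒟_dom : 𝒟 ⊆ HausdorffOp.hausdorffDomain Φ) :
    (HausdorffOp.IsBoundedOn Φ 𝒟 (HausdorffOp.triebelLizorkinNorm φ p q s) ↔
      HausdorffOp.IsZeroOp Φ) ∧
    (HausdorffOp.IsBoundedOn Φ 𝒟 (HausdorffOp.besovNorm φ p q s) ↔
      HausdorffOp.IsZeroOp Φ) ∧
    (HausdorffOp.IsBoundedOn Φ 𝒟 (HausdorffOp.modulationNorm η p q s) ↔
      HausdorffOp.IsZeroOp Φ) := by
  have : NeZero n := ⟨hn.ne'⟩
  exact ⟨(hφ.isAdmissibleNorm_triebelLizorkinNorm p hq s).isBoundedOn_iff hp₀ hp₁ hΦ h𝒟_test h𝒟_dom,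
    (hφ.isAdmissibleNorm_besovNorm p hq s).isBoundedOn_iff hp₀ hp₁ hΦ h𝒟_test h𝒟_dom,
    (hη.isAdmissibleNorm_modulationNorm p hq s).isBoundedOn_iff hp₀ hp₁ hΦ h𝒟_test h𝒟_dom⟩
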